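/- Theorem (Zhislin). Let $N\ge 2$ particles in $\mathbb{R}^3$ have masses $m_1,\dots,m_N>0$ and positions $r_i$, and let $H_0$ be their kinetic energy operator $-\sum_i \frac{\hbar^2}{2m_i}\Delta_{r_i}$ with the centre of mass removed, a self-adjoint operator with domain $D(H_0)$ in $L^2(\mathbb{R}^{3N-3})$. For a real parameter $\lambda$ put $$H(\lambda)=H_0+V(\lambda),\qquad V(\lambda)=\sum_{1\le i<j\le N}V_{ij}(\lambda;r_i-r_j),$$ with real pair potentials $V_{ij}(\lambda;\cdot)$ on $\mathbb{R}^3$. Let $L^\infty_\infty(\mathbb{R}^3)$ be the space of bounded Borel functions tending to zero at infinity, and write $E_{thr}(\lambda)=\inf\sigma_{ess}(H(\lambda))$. Assume: (R1) $H(\lambda)$ is defined for $\lambda=\lambda_1,\lambda_2,\dots$ and $\lambda=\lambda_{cr}$, where $\lim_{n\to\infty}\lambda_n=\lambda_{cr}$; (R2) there is $F\in L^2(\mathbb{R}^3)+L^\infty_\infty(\mathbb{R}^3)$ such that $V_{ij}(\lambda;\cdot)\in L^2(\mathbb{R}^3)+L^\infty_\infty(\mathbb{R}^3)$ and $|V_{ij}(\lambda;y)|\le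 F(y)$ for almost every $y$, for all $i<j$ and all $\lambda$ in (R1) (so that $H(\lambda)$ is self-adjoint on $D(H_0)$); (R3) $\lim_{n\to\infty}\|[V(\lambda_n)-V(\lambda_{cr})]f\|=0$ for every $f\in C_0^\infty(\mathbb{R}^{3N-3})$; (R4) for every $n$ there are $E(\lambda_n)\in\mathbb{R}$ and $\psi(\lambda_n)\in D(H_0)$ with $\|\psi(\lambda_n)\|=1$, $H(\lambda_n)\psi(\lambda_n)=E(\lambda_n)\psi(\lambda_n)$ and $E(\lambda_n)<E_{thr}(\lambda_n)$; (R5) $\lim_{n\to\infty}E(\lambda_n)=\lim_{n\to\infty}E_{thr}(\lambda_n)=E_{thr}(\lambda_{cr})$. Suppose that the sequence $\psi(\lambda_n)$ does not totally spread, that is, it is not true that $\lim_{n\to\infty}\|\chi_{\{|x|\le R\}}\psi(\lambda_n)\|=0$ for all $R>0$. Then there is $\psi_{cr}\in D(H_0)$, $\psi_{cr}\neq 0$, such that $H(\lambda_{cr})\psi_{cr}=E_{thr}(\lambda_{cr})\psi_{cr}$. -/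

import Mathlib

open Filter Topology MeasureTheory
open scoped ENNReal ContDiff Laplacian SchwartzMap

noncomputable section

/-! ## Closed-operator language for unbounded operators on a complex Hilbert space -/

namespace LinearPMap

variable {𝓗 : Type*} [NormedAddCommGroup 𝓗] [InnerProductSpace ℂ 𝓗]

/-- `z` belongs to the resolvent set of `A` if `A - z : D(A) → 𝓗` has an everywhere defined bounded
two-sided inverse `R`. -/
def resolventSet (A : 𝓗 →ₗ.[ℂ] 𝓗) : Set ℂ :=
  {z | ∃ R : 𝓗 →L[ℂ] 𝓗, (∀ u : A.domain, R (A u - z • (u : 𝓗)) = u) ∧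
    ∀ w : 𝓗, ∃ h : R w ∈ A.domain, A ⟨R w, h⟩ - z • R w = w}

/-- The spectrum of an unbounded operator. -/
def spectrum (A : 𝓗 →ₗ.[ℂ] 𝓗) : Set ℂ := (A.resolventSet)ᶜ

/-- The eigenspace `{u ∈ D(A) | A u = z u}`. -/
def eigenspace (A : 𝓗 →ₗ.[ℂ] 𝓗) (z : ℂ) : Submodule ℂ 𝓗 :=
  (LinearMap.ker (A.toFun - z • A.domain.subtype)).map A.domain.subtype

theorem mem_eigenspace_iff (A : 𝓗 →ₗ.[ℂ] 𝓗) (z : ℂ) (u : 𝓗) :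
    u ∈ A.eigenspace z ↔ ∃ h : u ∈ A.domain, A ⟨u, h⟩ = z • u := by
  constructor
  · rintro ⟨v, hv, rfl⟩
    exact ⟨v.2, sub_eq_zero.mp (by simpa using hv)⟩
  · rintro ⟨h, hu⟩
    refine ⟨⟨u, h⟩, ?_, rfl⟩
    change A ⟨u, h⟩ - z • u = 0
    rw [hu, sub_self]

/-- The discrete spectrum: eigenvalues of finite multiplicity that are isolated points of the
spectrum. -/
def discreteSpectrum (A : 𝓗 →ₗ.[ℂ] 𝓗) : Set ℂ :=
  {z | A.eigenspace z ≠ ⊥ ∧ FiniteDimensional ℂ (A.eigenspace z) ∧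
    ∃ ε > 0, ∀ w ∈ A.spectrum, ‖w - z‖ < ε → w = z}

/-- The essential spectrum (of a self-adjoint operator): the spectrum without the discrete
spectrum. -/
def essentialSpectrum (A : 𝓗 →ₗ.[ℂ] 𝓗) : Set ℂ := A.spectrum \ A.discreteSpectrum

end LinearPMap

namespace NBody

/-! ## The operators `-Δ` and multiplication by a real function on `L²` -/

section Operators

variable (X : Type*) [NormedAddCommGroup X] [InnerProductSpace ℝ X] [FiniteDimensional ℝ X]
  [MeasurableSpace X] [BorelSpace X]

/-- The Hilbert space `L²(X; ℂ)`. -/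
abbrev L2 : Type _ := Lp ℂ 2 (volume : Measure X)

/-- The graph of `-Δ` on `L²`: pairs `(f, g)` of `L²` functions such that `g = -Δ f` in the sense of
tempered distributions. -/
def negLaplacianGraph : Submodule ℂ (L2 X × L2 X) where
  carrier := {p | (p.2 : 𝓢'(X, ℂ)) = -Δ (p.1 : 𝓢'(X, ℂ))}
  zero_mem' := by
    simp only [Set.mem_ofPred_eq, Prod.fst_zero, Prod.snd_zero,
      ← Lp.toTemperedDistributionCLM_apply, map_zero,
      ← TemperedDistribution.laplacianCLM_apply, neg_zero]
  add_mem' := by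
    intro p q hp hq
    simp only [Set.mem_ofPred_eq, Prod.fst_add, Prod.snd_add,
      ← Lp.toTemperedDistributionCLM_apply, map_add,
      ← TemperedDistribution.laplacianCLM_apply] at hp hq ⊢
    rw [hp, hq, neg_add]
  smul_mem' := by
    intro c p hp
    simp only [Set.mem_ofPred_eq, Prod.smul_fst, Prod.smul_snd,
      ← Lp.toTemperedDistributionCLM_apply, map_smul,
      ← TemperedDistribution.laplacianCLM_apply] at hp ⊢
    rw [hp, smul_neg]

/-- The self-adjoint operator `-Δ` on `L²(X)`, on the domain
`{f ∈ L² | Δ f ∈ L²} = H²(X)`. -/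
def negLaplacian : L2 X →ₗ.[ℂ] L2 X := (negLaplacianGraph X).toLinearPMap

theorem negLaplacian_graph : (negLaplacian X).graph = negLaplacianGraph X := by
  apply Submodule.toLinearPMap_graph_eq
  rintro ⟨f, g⟩ hp hf
  obtain rfl : f = 0 := hf
  change (g : 𝓢'(X, ℂ)) = -Δ ((0 : L2 X) : 𝓢'(X, ℂ)) at hp
  rw [← Lp.toTemperedDistributionCLM_apply, ← Lp.toTemperedDistributionCLM_apply,
    map_zero, ← TemperedDistribution.laplacianCLM_apply, map_zero, neg_zero] at hp
  have : g ∈ (Lp.toTemperedDistributionCLM ℂ (volume : Measure X) 2).ker := hp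
  rwa [Lp.ker_toTemperedDistributionCLM_eq_bot] at this

/-- `f ∈ D(-Δ)` and `-Δ f = g` if and only if `g = -Δ f` as tempered distributions. -/
theorem negLaplacian_spec (f g : L2 X) :
    (∃ h : f ∈ (negLaplacian X).domain, negLaplacian X ⟨f, h⟩ = g) ↔
      (g : 𝓢'(X, ℂ)) = -Δ (f : 𝓢'(X, ℂ)) := by
  have h1 : (f, g) ∈ (negLaplacian X).graph ↔ (f, g) ∈ negLaplacianGraph X := by
    rw [negLaplacian_graph]
  refine Iff.trans ?_ h1
  rw [LinearPMap.mem_graph_iff]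
  constructor
  · rintro ⟨h, hg⟩
    exact ⟨⟨f, h⟩, rfl, hg⟩
  · rintro ⟨y, hy, hg⟩
    obtain rfl : (y : L2 X) = f := hy
    exact ⟨y.2, hg⟩

variable {X}

/-- The graph of multiplication by `v`: pairs `(f, g)` of `L²` functions with `g = v f` almost
everywhere. -/
def mulGraph (v : X → ℝ) : Submodule ℂ (L2 X × L2 X) where
  carrier := {p | p.2 =ᵐ[volume] fun x => (v x : ℂ) * p.1 x}
  zero_mem' := by
    filter_upwards [Lp.coeFn_zero ℂ 2 (volume : Measure X)] with x hx
    simp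
  add_mem' := by
    intro p q hp hq
    filter_upwards [hp, hq, Lp.coeFn_add p.1 q.1, Lp.coeFn_add p.2 q.2] with x h1 h2 h3 h4
    simp only [Prod.fst_add, Prod.snd_add, h3, h4, Pi.add_apply, h1, h2, mul_add]
  smul_mem' := by
    intro c p hp
    filter_upwards [hp, Lp.coeFn_smul c p.1, Lp.coeFn_smul c p.2] with x h1 h2 h3
    simp only [Prod.smul_fst, Prod.smul_snd, h2, h3, Pi.smul_apply, h1, smul_eq_mul]
    ring

/-- The operator of multiplication by the real function `v` on its maximal domain
`{f ∈ L² | v f ∈ L²}`. -/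
def mulOperator (v : X → ℝ) : L2 X →ₗ.[ℂ] L2 X := (mulGraph v).toLinearPMap

theorem mulOperator_graph (v : X → ℝ) : (mulOperator v).graph = mulGraph v := by
  apply Submodule.toLinearPMap_graph_eq
  rintro ⟨f, g⟩ hp hf
  obtain rfl : f = 0 := hf
  change g = 0
  apply Lp.ext
  filter_upwards [hp, Lp.coeFn_zero ℂ 2 (volume : Measure X)] with x h1 h2
  simpa [h2] using h1

/-- `f ∈ D(v)` and `v f = g` if and only if `g = v f` almost everywhere. -/
theorem mulOperator_spec (v : X → ℝ) (f g : L2 X) :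
    (∃ h : f ∈ (mulOperator v).domain, mulOperator v ⟨f, h⟩ = g) ↔
      g =ᵐ[volume] fun x => (v x : ℂ) * f x := by
  have h1 : (f, g) ∈ (mulOperator v).graph ↔ (f, g) ∈ mulGraph v := by
    rw [mulOperator_graph]
  refine Iff.trans ?_ h1
  rw [LinearPMap.mem_graph_iff]
  constructor
  · rintro ⟨h, hg⟩
    exact ⟨⟨f, h⟩, rfl, hg⟩
  · rintro ⟨y, hy, hg⟩
    obtain rfl : (y : L2 X) = f := hy
    exact ⟨y.2, hg⟩

/-- A sequence `f n` in `L²(X)` spreads totally if `‖χ_{|x| ≤ R} f n‖ → 0` for every `R > 0`. -/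
def TotallySpreading (f : ℕ → L2 X) : Prop :=
  ∀ R : ℝ, 0 < R →
    Tendsto (fun n => eLpNorm ((Metric.closedBall (0 : X) R).indicator (f n)) 2 volume) atTop (𝓝 0)

end Operators

/-! ## The `N`-particle Hamiltonian with the centre of mass removed -/

/-- Physical space `ℝ³`. -/
abbrev Space : Type := EuclideanSpace ℝ (Fin 3)

/-- In the mass-scaled coordinates `x i = (√(2 m i) / ħ) r i` of `N` particles with masses `m i` and
positions `r i`, the centre-of-mass condition `∑ i, m i • r i = 0` reads `∑ i, √(m i) • x i = 0`. -/
def centredSubspace {N : ℕ} (m : Fin N → ℝ) : Submodule ℝ (PiLp 2 fun _ : Fin N => Space) where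
  carrier := {x | ∑ i, √(m i) • x i = 0}
  zero_mem' := by simp
  add_mem' := by
    intro x y hx hy
    simp only [Set.mem_ofPred_eq, PiLp.add_apply, smul_add, Finset.sum_add_distrib] at hx hy ⊢
    rw [hx, hy, add_zero]
  smul_mem' := by
    intro c x hx
    simp only [Set.mem_ofPred_eq, PiLp.smul_apply] at hx ⊢
    simp only [smul_comm _ c, ← Finset.smul_sum, hx, smul_zero]

/-- The configuration space `≅ ℝ^{3N-3}` of `N` particles in the centre-of-mass frame, with the
Euclidean structure of the mass-scaled coordinates. In these coordinates the kinetic energy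
`-∑ i, ħ² / (2 m i) Δ_{r i}` is `-Δ` on `ℝ^{3N}`, and removing the centre of mass means restricting
`-Δ` to this subspace. (It is a type of its own so that `volume` on it is the Lebesgue measure of
its Euclidean structure.) -/
def RelSpace {N : ℕ} (m : Fin N → ℝ) : Type := centredSubspace m

instance {N : ℕ} (m : Fin N → ℝ) : NormedAddCommGroup (RelSpace m) :=
  inferInstanceAs (NormedAddCommGroup (centredSubspace m))

instance {N : ℕ} (m : Fin N → ℝ) : InnerProductSpace ℝ (RelSpace m) :=
  inferInstanceAs (InnerProductSpace ℝ (centredSubspace m))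

instance {N : ℕ} (m : Fin N → ℝ) : FiniteDimensional ℝ (RelSpace m) :=
  inferInstanceAs (FiniteDimensional ℝ (centredSubspace m))

instance {N : ℕ} (m : Fin N → ℝ) : MeasurableSpace (RelSpace m) := borel (RelSpace m)

instance {N : ℕ} (m : Fin N → ℝ) : BorelSpace (RelSpace m) := ⟨rfl⟩

/-- The position vector `r i = (ħ / √(2 m i)) x i` of particle `i`. -/
def position {N : ℕ} (ℏ : ℝ) (m : Fin N → ℝ) (x : RelSpace m) (i : Fin N) : Space :=
  (ℏ / √(2 * m i)) • (x : centredSubspace m).1 i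

/-- The total potential `∑_{i < j} V i j (r i - r j)`. -/
def totalPotential {N : ℕ} (ℏ : ℝ) (m : Fin N → ℝ) (V : Fin N → Fin N → Space → ℝ)
    (x : RelSpace m) : ℝ :=
  ∑ i, ∑ j ∈ Finset.Ioi i, V i j (position ℏ m x i - position ℏ m x j)

/-- The kinetic energy operator with the centre of mass removed. -/
def kinetic {N : ℕ} (m : Fin N → ℝ) : L2 (RelSpace m) →ₗ.[ℂ] L2 (RelSpace m) :=
  negLaplacian (RelSpace m)

/-- The Hamiltonian `H₀ + ∑_{i < j} V i j (r i - r j)`, an operator sum: its domain consists of the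
`f ∈ D(H₀)` for which the product of the potential and `f` is in `L²`. -/
def hamiltonian {N : ℕ} (ℏ : ℝ) (m : Fin N → ℝ) (V : Fin N → Fin N → Space → ℝ) :
    L2 (RelSpace m) →ₗ.[ℂ] L2 (RelSpace m) :=
  kinetic m + mulOperator (totalPotential ℏ m V)

/-- The threshold `inf σ_ess`. -/
def threshold {N : ℕ} (ℏ : ℝ) (m : Fin N → ℝ) (V : Fin N → Fin N → Space → ℝ) : ℝ :=
  sInf {μ : ℝ | (μ : ℂ) ∈ (hamiltonian ℏ m V).essentialSpectrum}

/-- The class `L² + L^∞_∞` of functions on `ℝ³`: sums of a square integrable function and a bounded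
Borel function that goes to zero at infinity. -/
def MemL2AddLinfty (F : Space → ℝ) : Prop :=
  ∃ f g : Space → ℝ, F = f + g ∧ MemLp f 2 volume ∧
    Measurable g ∧ (∃ C, ∀ y, |g y| ≤ C) ∧ Tendsto g (cocompact Space) (𝓝 0)

end NBody

end

noncomputable section

namespace NBody

open FourierTransform LineDeriv

/-! ### Fourier description of the domain of `-Δ`. -/

section FourierSide

variable {X : Type*} [NormedAddCommGroup X] [InnerProductSpace ℝ X] [FiniteDimensional ℝ X]
  [MeasurableSpace X] [BorelSpace X]

/-! The proof is a weak compactness argument. The common majorant of the pair potentials makes all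
`V(λₙ)` bounded relative to `-Δ` with one set of constants and relative bound below one. Since the
`E(λₙ)` are bounded, the eigenvalue equation then bounds `‖Δψ(λₙ)‖`, and a subsequence of `ψ(λₙ)`
and of `-Δψ(λₙ)` converges weakly.

The weak limit is nonzero: by Rellich (`totallySpreading_of_tendsto_inner_zero`), a sequence bounded
in the graph norm and weakly null loses its mass on every ball, and the subsequence was chosen so
that this fails on one ball. The limit solves the limiting equation: the graph of `-Δ` is weakly
closed, and against a test function `u` one has `⟨u, Vₙψₙ⟩ = ⟨Vₙu, ψₙ⟩`, where `Vₙu` converges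
strongly and `ψₙ` weakly. This is `exists_eigenfunction_of_not_totallySpreading`.

The analytic input is Kato's bound `RelativelySmall.comp_memLp_two` for a potential depending on `x`
only through a surjection `L` onto `ℝ³`. It comes from the Sobolev inequality on three-dimensional
slices, integrated over all slices. Fourier transforms carry the factor `2π` in the exponent, hence
the operator `1 - (2π)⁻²Δ` with symbol `1 + |ξ|²` throughout. -/

theorem locallyIntegrable_of_memLp_two {f : X → ℂ} (hf : MemLp f 2 (volume : Measure X)) :
    LocallyIntegrable f volume :=
  hf.locallyIntegrable (by norm_num)

theorem ae_eq_of_integral_schwartz_mul_eq {f g : X → ℂ} (hf : LocallyIntegrable f volume)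
    (hg : LocallyIntegrable g volume)
    (h : ∀ φ : 𝓢(X, ℂ), ∫ x, φ x * f x = ∫ x, φ x * g x) : f =ᵐ[volume] g := by
  apply ae_eq_of_integral_contDiff_smul_eq hf hg
  intro φ hφ hφs
  have hc : HasCompactSupport (fun x => (φ x : ℂ)) := hφs.comp_left (g := fun y : ℝ => (y : ℂ)) rfl
  have hd : ContDiff ℝ ∞ (fun x => (φ x : ℂ)) := Complex.ofRealCLM.contDiff.comp hφ
  simpa using! h (hc.toSchwartzMap hd)

theorem mem_negLaplacianGraph_iff {f g : L2 X} :
    (f, g) ∈ negLaplacianGraph X ↔ (g : 𝓢'(X, ℂ)) = -Δ (f : 𝓢'(X, ℂ)) :=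
  Iff.rfl

/-- The Fourier transform turns `-Δ` into multiplication by `(2π)² |ξ|²`. -/
theorem fourier_ae_eq_of_mem_negLaplacianGraph {f g : L2 X} (h : (f, g) ∈ negLaplacianGraph X) :
    (𝓕 g : L2 X) =ᵐ[volume]
      fun ξ => (((2 * Real.pi) ^ 2 * ‖ξ‖ ^ 2 : ℝ) : ℂ) * (𝓕 f : L2 X) ξ := by
  have h' : (g : 𝓢'(X, ℂ)) = -Δ (f : 𝓢'(X, ℂ)) := h
  rw [TemperedDistribution.laplacian_eq_fourierMultiplierCLM,
    TemperedDistribution.fourierMultiplierCLM_apply, Lp.fourier_toTemperedDistribution_eq] at h'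
  have hg : Function.HasTemperateGrowth (fun x : X => ((‖x‖ ^ 2 : ℝ) : ℂ)) := by fun_prop
  have hloc : LocallyIntegrable (fun x => (𝓕 f : L2 X) x) volume :=
    locallyIntegrable_of_memLp_two (Lp.memLp _)
  apply ae_eq_of_integral_schwartz_mul_eq (locallyIntegrable_of_memLp_two (Lp.memLp _))
  · rw [← locallyIntegrableOn_univ] at hloc ⊢
    refine hloc.continuousOn_mul (g := fun ξ : X => (((2 * Real.pi) ^ 2 * ‖ξ‖ ^ 2 : ℝ) : ℂ)) ?_
      isOpen_univ.isLocallyClosed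
    fun_prop
  intro φ
  have h3 := congrArg (fun T : 𝓢'(X, ℂ) => T (𝓕 φ)) h'
  have h4 := congrArg (fun T : 𝓢'(X, ℂ) => T φ) (Lp.fourier_toTemperedDistribution_eq g)
  simp only [neg_smul, neg_neg, Lp.toTemperedDistribution_apply, smul_apply,
    TemperedDistribution.fourierInv_apply, TemperedDistribution.fourier_apply,
    FourierTransform.fourierInv_fourier_eq,
    TemperedDistribution.smulLeftCLM_apply_apply, SchwartzMap.smulLeftCLM_apply_apply hg,
    smul_eq_mul] at h3 h4
  rw [← h4, h3, ← integral_smul]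
  refine integral_congr_ae (.of_forall fun x => ?_)
  simp only [Complex.real_smul]
  push_cast
  ring

theorem schwartz_mem_negLaplacianGraph (u : 𝓢(X, ℂ)) :
    (u.toLp 2 volume, -((Δ u).toLp 2 volume)) ∈ negLaplacianGraph X := by
  rw [mem_negLaplacianGraph_iff, ← Lp.toTemperedDistributionCLM_apply, map_neg, Lp.toTemperedDistributionCLM_apply,
    Lp.toTemperedDistribution_toLp_eq, Lp.toTemperedDistribution_toLp_eq,
    TemperedDistribution.laplacian_toTemperedDistributionCLM_eq]

/-- On `L¹ ∩ L²` the inverse Fourier transform of `L²` is given by the Fourier integral. -/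
theorem fourierInv_ae_eq_of_integrable (p : L2 X) (hp : Integrable p volume) :
    (𝓕⁻ p : L2 X) =ᵐ[volume] 𝓕⁻ (p : X → ℂ) := by
  have hcont : Continuous (𝓕⁻ (p : X → ℂ)) := by
    have := VectorFourier.fourierIntegral_continuous Real.continuous_fourierChar
      (L := innerₗ X) (by exact continuous_inner) hp
    rw [show 𝓕⁻ (p : X → ℂ) = fun x => 𝓕 (p : X → ℂ) (-x) from
      funext fun x => Real.fourierInv_eq_fourier_neg _ _]
    exact this.comp continuous_neg
  apply ae_eq_of_integral_schwartz_mul_eq (locallyIntegrable_of_memLp_two (Lp.memLp _))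
    hcont.locallyIntegrable
  intro φ
  have h1 := congrArg (fun T : 𝓢'(X, ℂ) => T φ) (Lp.fourierInv_toTemperedDistribution_eq p)
  simp only [TemperedDistribution.fourierInv_apply, Lp.toTemperedDistribution_apply,
    smul_eq_mul] at h1
  rw [← h1]
  -- With the pairing `-⟨·,·⟩` the Fourier integral is the inverse transform, so the multiplication
  -- formula moves `𝓕⁻` from the test function to `p`.
  have h2 := VectorFourier.integral_fourierIntegral_smul_eq_flip (L := -innerₗ X)
    (μ := (volume : Measure X)) (ν := (volume : Measure X)) (f := φ) (g := p)
    Real.continuous_fourierChar ((continuous_inner (𝕜 := ℝ) (E := X)).neg)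
    φ.integrable hp
  have e1 : ∀ ξ, VectorFourier.fourierIntegral Real.fourierChar volume (-innerₗ X) φ ξ
      = (𝓕⁻ φ) ξ := by
    intro ξ
    rw [SchwartzMap.fourierInv_coe, Real.fourierInv_eq]
    simp [VectorFourier.fourierIntegral]
  have e2 : ∀ x, VectorFourier.fourierIntegral Real.fourierChar volume (-innerₗ X).flip p x
      = (𝓕⁻ (p : X → ℂ)) x := by
    intro ξ
    rw [Real.fourierInv_eq]
    simp [VectorFourier.fourierIntegral, real_inner_comm]
  simp only [e1, e2, smul_eq_mul] at h2
  exact h2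

end FourierSide

set_option linter.unusedSectionVars false

/-! ### Sobolev inequality on slices, for Schwartz functions. -/

section SobolevSlices

variable {X : Type*} [NormedAddCommGroup X] [InnerProductSpace ℝ X] [FiniteDimensional ℝ X]
  [MeasurableSpace X] [BorelSpace X]

theorem eLpNorm_two_sq {Y E : Type*} [MeasurableSpace Y] {μ : Measure Y} [NormedAddCommGroup E]
    (f : Y → E) : eLpNorm f 2 μ ^ 2 = ∫⁻ x, ‖f x‖ₑ ^ 2 ∂μ := by
  rw [eLpNorm_eq_lintegral_rpow_enorm_toReal (by norm_num) (by norm_num)]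
  simp only [ENNReal.toReal_ofNat, ENNReal.rpow_ofNat, one_div]
  rw [← ENNReal.rpow_natCast, ← ENNReal.rpow_mul]
  norm_num

theorem eLpNorm_fourier_schwartz (u : 𝓢(X, ℂ)) :
    eLpNorm (⇑(𝓕 u : 𝓢(X, ℂ))) 2 volume = eLpNorm u 2 volume := by
  have key : ∀ a b : 𝓢(X, ℂ), ‖a.toLp 2 volume‖ = ‖b.toLp 2 volume‖ →
      eLpNorm a 2 volume = eLpNorm b 2 volume := by
    intro a b h
    have ha : eLpNorm a 2 (volume : Measure X) ≠ ⊤ := (a.memLp 2 volume).2.ne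
    have hb : eLpNorm b 2 (volume : Measure X) ≠ ⊤ := (b.memLp 2 volume).2.ne
    rw [SchwartzMap.norm_toLp, SchwartzMap.norm_toLp] at h
    exact (ENNReal.toReal_eq_toReal_iff' ha hb).mp h
  exact key _ _ (SchwartzMap.norm_fourier_toL2_eq u)

/-- The operator `1 - (2π)⁻² ∑ᵢ ∂_{eᵢ}²`, whose Fourier symbol is `1 + ∑ᵢ ⟨ξ, eᵢ⟩²`. -/
def helmholtz {ι : Type*} [Fintype ι] (e : ι → X) (u : 𝓢(X, ℂ)) : 𝓢(X, ℂ) :=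
  u - (((2 * Real.pi) ^ 2)⁻¹ : ℝ) • ∑ i, ∂_{e i} (∂_{e i} u)

theorem helmholtz_apply {ι : Type*} [Fintype ι] (e : ι → X) (u : 𝓢(X, ℂ)) (x : X) :
    helmholtz e u x = u x - (((2 * Real.pi) ^ 2)⁻¹ : ℝ) • ∑ i, ∂_{e i} (∂_{e i} u) x := by
  simp [helmholtz]

theorem fourier_helmholtz {ι : Type*} [Fintype ι] (e : ι → X) (u : 𝓢(X, ℂ)) (ξ : X) :
    𝓕 (helmholtz e u) ξ = ((1 + ∑ i, inner ℝ ξ (e i) ^ 2 : ℝ) : ℂ) * 𝓕 u ξ := by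
  have h1 : 𝓕 (helmholtz e u) =
      𝓕 u - ((((2 * Real.pi) ^ 2)⁻¹ : ℝ) : ℂ) • ∑ i, 𝓕 (∂_{e i} (∂_{e i} u)) := by
    have : helmholtz e u = u - ((((2 * Real.pi) ^ 2)⁻¹ : ℝ) : ℂ) • ∑ i, ∂_{e i} (∂_{e i} u) := by
      ext x; simp [helmholtz]
    rw [this]
    simp only [← FourierTransform.fourierCLM_apply (R := ℂ)]
    rw [map_sub, map_smul, map_sum]
  have h2 : ∀ i, 𝓕 (∂_{e i} (∂_{e i} u)) ξ
      = -((2 * Real.pi) ^ 2 * inner ℝ ξ (e i) ^ 2 : ℝ) * 𝓕 u ξ := by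
    intro i
    have ht : Function.HasTemperateGrowth (fun x : X => inner ℝ x (e i)) := by fun_prop
    rw [SchwartzMap.fourier_lineDerivOp_eq, SchwartzMap.fourier_lineDerivOp_eq]
    simp only [smul_apply, SchwartzMap.smulLeftCLM_apply_apply ht,
      smul_eq_mul, Complex.real_smul]
    push_cast
    ring_nf
    simp
  have hpi : ((2 * Real.pi : ℝ) : ℂ) ≠ 0 := by
    exact_mod_cast (by positivity : (2 * Real.pi : ℝ) ≠ 0)
  rw [h1]
  simp only [sub_apply, smul_apply, sum_apply, h2, smul_eq_mul]
  rw [← Finset.sum_mul]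
  push_cast
  rw [Finset.sum_neg_distrib, ← Finset.mul_sum]
  push_cast at hpi
  field_simp
  ring

/-- The Sobolev inequality `|v(0)| ≤ K ‖(1 - (2π)⁻² Δ) v‖` in dimension at most three. -/
theorem exists_enorm_apply_zero_le {S : Type*} [NormedAddCommGroup S] [InnerProductSpace ℝ S]
    [FiniteDimensional ℝ S] [MeasurableSpace S] [BorelSpace S] (hS : Module.finrank ℝ S < 4)
    {ι : Type*} [Fintype ι] (e : OrthonormalBasis ι ℝ S) :
    ∃ K : ℝ≥0∞, K ≠ ⊤ ∧ ∀ v : 𝓢(S, ℂ), ‖v 0‖ₑ ≤ K * eLpNorm (helmholtz e v) 2 volume := by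
  -- This weight is square integrable because the dimension is below `4`. Cauchy–Schwarz applied to
  -- `v(0) = ∫ φ · (symbol · 𝓕 v)` and Plancherel then give the bound.
  let φ : S → ℝ := fun ξ => (1 + ‖ξ‖ ^ 2)⁻¹
  have hφc : Continuous φ := by
    refine Continuous.inv₀ (by fun_prop) fun x => by positivity
  have hφ : MemLp φ 2 volume := by
    rw [memLp_two_iff_integrable_sq hφc.aestronglyMeasurable]
    have := integrable_rpow_neg_one_add_norm_sq (E := S) (μ := volume) (r := 4)
      (by exact_mod_cast hS)
    refine this.congr (.of_forall fun x => ?_)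
    simp only [φ]
    rw [show (-4 / 2 : ℝ) = -((2 : ℕ) : ℝ) by norm_num, Real.rpow_neg (by positivity),
      Real.rpow_natCast, inv_pow]
  refine ⟨eLpNorm φ 2 volume, hφ.2.ne, fun v => ?_⟩
  have h0 : v 0 = ∫ ξ, 𝓕 v ξ := by
    have : v 0 = 𝓕⁻ (𝓕 v) 0 := by rw [FourierTransform.fourierInv_fourier_eq]
    rw [this, SchwartzMap.fourierInv_coe, Real.fourierInv_eq]
    simp
  have h1 : ∀ ξ, 𝓕 v ξ = φ ξ • 𝓕 (helmholtz e v) ξ := by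
    intro ξ
    have hn : ((1 + ‖ξ‖ ^ 2 : ℝ) : ℂ) ≠ 0 := by
      exact_mod_cast (by positivity : (1 + ‖ξ‖ ^ 2 : ℝ) ≠ 0)
    rw [fourier_helmholtz, e.sum_sq_inner_left, Complex.real_smul, ← mul_assoc]
    simp only [φ]
    rw [← Complex.ofReal_mul, inv_mul_cancel₀ (by positivity)]
    simp
  calc ‖v 0‖ₑ ≤ eLpNorm (fun ξ => 𝓕 v ξ) 1 volume := by
        rw [h0, eLpNorm_one_eq_lintegral_enorm]
        exact enorm_integral_le_lintegral_enorm _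
    _ = eLpNorm (φ • ⇑(𝓕 (helmholtz e v) : 𝓢(S, ℂ))) 1 volume := by
        congr 1; ext ξ; exact h1 ξ
    _ ≤ eLpNorm φ 2 volume * eLpNorm (⇑(𝓕 (helmholtz e v) : 𝓢(S, ℂ))) 2 volume :=
        eLpNorm_smul_le_mul_eLpNorm (SchwartzMap.continuous _).aestronglyMeasurable
          hφc.aestronglyMeasurable
    _ = _ := by rw [eLpNorm_fourier_schwartz]

section Slices

variable {S : Type*} [NormedAddCommGroup S] [InnerProductSpace ℝ S]

/-- The restriction of a Schwartz function to the affine subspace `x + range J`. -/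
def slice (J : S →L[ℝ] X) {L : X →L[ℝ] S} (hJ : ∀ s, L (J s) = s) (u : 𝓢(X, ℂ)) (x : X) :
    𝓢(S, ℂ) :=
  SchwartzMap.compCLMOfAntilipschitz ℝ (K := ‖L‖₊) (g := fun s => x + J s)
    (by fun_prop) (by
      refine AntilipschitzWith.of_le_mul_dist fun s t => ?_
      have : s - t = L ((x + J s) - (x + J t)) := by simp [hJ]
      rw [dist_eq_norm, this, dist_eq_norm]
      exact L.le_opNorm _) u

@[simp]
theorem slice_apply (J : S →L[ℝ] X) {L : X →L[ℝ] S} (hJ : ∀ s, L (J s) = s) (u : 𝓢(X, ℂ))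
    (x : X) (s : S) : slice J hJ u x s = u (x + J s) := by
  simp [slice]

theorem lineDerivOp_slice (J : S →L[ℝ] X) {L : X →L[ℝ] S} (hJ : ∀ s, L (J s) = s)
    (u : 𝓢(X, ℂ)) (x : X) (v : S) : ∂_{v} (slice J hJ u x) = slice J hJ (∂_{J v} u) x := by
  ext s
  rw [slice_apply, SchwartzMap.lineDerivOp_apply, SchwartzMap.lineDerivOp_apply]
  simp only [lineDeriv, slice_apply, map_add, map_smul, add_assoc]

/-- Derivatives of a slice are derivatives of `u` along `range J`. The vectors `J (e i)` need be
neither orthonormal nor spanning, which is why `helmholtz` takes an arbitrary family. -/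
theorem helmholtz_slice [FiniteDimensional ℝ S] [MeasurableSpace S] [BorelSpace S]
    (J : S →L[ℝ] X) {L : X →L[ℝ] S} (hJ : ∀ s, L (J s) = s)
    {ι : Type*} [Fintype ι] (e : ι → S) (u : 𝓢(X, ℂ)) (x : X) (s : S) :
    helmholtz e (slice J hJ u x) s = helmholtz (fun i => J (e i)) u (x + J s) := by
  simp only [helmholtz_apply, lineDerivOp_slice, slice_apply]

end Slices

/-- A square integrable function of a three-dimensional projection of `x` times a Schwartz
function. -/
theorem exists_eLpNorm_comp_mul_schwartz_le {S : Type*} [NormedAddCommGroup S]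
    [InnerProductSpace ℝ S] [FiniteDimensional ℝ S] [MeasurableSpace S] [BorelSpace S]
    (hS : Module.finrank ℝ S < 4) (J : S →L[ℝ] X) {L : X →L[ℝ] S} (hJ : ∀ s, L (J s) = s)
    {ι : Type*} [Fintype ι] (e : OrthonormalBasis ι ℝ S) :
    ∃ K : ℝ≥0∞, K ≠ ⊤ ∧ ∀ f : S → ℝ, Measurable f → ∀ u : 𝓢(X, ℂ),
      eLpNorm (fun x => (f (L x) : ℂ) * u x) 2 volume ≤
        K * eLpNorm f 2 volume * eLpNorm (helmholtz (fun i => J (e i)) u) 2 volume := by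
  obtain ⟨K, hK, hle⟩ := exists_enorm_apply_zero_le hS e
  refine ⟨K, hK, fun f hf u => ?_⟩
  obtain ⟨h, hh⟩ : ∃ h : X → ℂ, h = ⇑(helmholtz (fun i => J (e i)) u) := ⟨_, rfl⟩
  have hhc : Measurable h := hh ▸ (SchwartzMap.continuous _).measurable
  rw [← hh]
  -- Sobolev at the origin of the slice through `x`.
  have hpt : ∀ x, ‖u x‖ₑ ^ 2 ≤ K ^ 2 * ∫⁻ s, ‖h (x + J s)‖ₑ ^ 2 := by
    intro x
    have h1 := hle (slice J hJ u x)
    rw [slice_apply, map_zero, add_zero] at h1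
    calc ‖u x‖ₑ ^ 2 ≤ (K * eLpNorm (helmholtz e (slice J hJ u x)) 2 volume) ^ 2 := by gcongr
      _ = _ := by
        rw [mul_pow, eLpNorm_two_sq]
        simp only [helmholtz_slice, hh]
  rw [← ENNReal.pow_le_pow_left_iff two_ne_zero, mul_pow, mul_pow, eLpNorm_two_sq, eLpNorm_two_sq,
    eLpNorm_two_sq]
  have hm1 : Measurable fun x : X => ‖f (L x)‖ₑ ^ 2 := by fun_prop
  calc ∫⁻ x, ‖(f (L x) : ℂ) * u x‖ₑ ^ 2
      ≤ ∫⁻ x, ∫⁻ s, K ^ 2 * (‖f (L x)‖ₑ ^ 2 * ‖h (x + J s)‖ₑ ^ 2) := by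
        refine lintegral_mono fun x => ?_
        have : ‖(f (L x) : ℂ)‖ₑ = ‖f (L x)‖ₑ := by
          rw [← ofReal_norm, ← ofReal_norm, Complex.norm_real]
        rw [enorm_mul, mul_pow, this, lintegral_const_mul _ (by fun_prop),
          lintegral_const_mul _ (by fun_prop), mul_left_comm]
        gcongr
        exact hpt x
    _ = ∫⁻ s, ∫⁻ x, K ^ 2 * (‖f (L x)‖ₑ ^ 2 * ‖h (x + J s)‖ₑ ^ 2) := by
        rw [lintegral_lintegral_swap]
        apply Measurable.aemeasurable
        fun_prop
    -- Translating `x` by `J s` moves the shift from `h` to `f`, since `L (J s) = s`; the two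
    -- factors then separate without coordinates adapted to `L`.
    _ = ∫⁻ s, ∫⁻ x, K ^ 2 * (‖f (L x - s)‖ₑ ^ 2 * ‖h x‖ₑ ^ 2) := by
        refine lintegral_congr fun s => ?_
        rw [← lintegral_add_right_eq_self
          (fun x => K ^ 2 * (‖f (L x - s)‖ₑ ^ 2 * ‖h x‖ₑ ^ 2)) (J s)]
        simp [hJ]
    _ = ∫⁻ x, ∫⁻ s, K ^ 2 * (‖f (L x - s)‖ₑ ^ 2 * ‖h x‖ₑ ^ 2) := by
        rw [lintegral_lintegral_swap]
        apply Measurable.aemeasurable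
        fun_prop
    _ = ∫⁻ x, K ^ 2 * (∫⁻ s, ‖f s‖ₑ ^ 2) * ‖h x‖ₑ ^ 2 := by
        refine lintegral_congr fun x => ?_
        rw [lintegral_const_mul _ (by fun_prop), lintegral_mul_const _ (by fun_prop),
          lintegral_sub_left_eq_self (fun s => ‖f s‖ₑ ^ 2) (L x), mul_assoc]
    _ = _ := lintegral_const_mul _ (by fun_prop)

/-- `(1 - (2π)⁻² Δ)⁻¹` on Schwartz functions. -/
def helmholtzInv (w : 𝓢(X, ℂ)) : 𝓢(X, ℂ) :=
  𝓕⁻ (SchwartzMap.smulLeftCLM ℂ (fun ξ : X => (((1 + ‖ξ‖ ^ 2) ^ (-1 : ℝ) : ℝ) : ℂ)) (𝓕 w))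

theorem fourier_helmholtzInv (w : 𝓢(X, ℂ)) (ξ : X) :
    𝓕 (helmholtzInv w) ξ = (((1 + ‖ξ‖ ^ 2)⁻¹ : ℝ) : ℂ) * 𝓕 w ξ := by
  rw [helmholtzInv, FourierTransform.fourier_fourierInv_eq, SchwartzMap.smulLeftCLM_apply_apply,
    Real.rpow_neg_one, smul_eq_mul]
  have := Function.hasTemperateGrowth_one_add_norm_sq_rpow X (-1)
  fun_prop

/-- On the Fourier side the quotient `(1 + ∑ᵢ ⟨ξ, eᵢ⟩²) / (1 + |ξ|²)` is bounded by Cauchy–Schwarz,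
so the full Laplacian controls the derivatives along the slices. -/
theorem exists_eLpNorm_helmholtz_helmholtzInv_le {ι : Type*} [Fintype ι] (e : ι → X) :
    ∃ c : ℝ≥0∞, c ≠ ⊤ ∧ ∀ w : 𝓢(X, ℂ),
      eLpNorm (helmholtz e (helmholtzInv w)) 2 volume ≤ c * eLpNorm w 2 volume := by
  refine ⟨ENNReal.ofReal (1 + ∑ i, ‖e i‖ ^ 2), ENNReal.ofReal_ne_top, fun w => ?_⟩
  rw [← eLpNorm_fourier_schwartz, ← eLpNorm_fourier_schwartz w]
  refine eLpNorm_le_mul_eLpNorm_of_ae_le_mul (.of_forall fun ξ => ?_) 2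
  rw [fourier_helmholtz, fourier_helmholtzInv, ← mul_assoc, ← Complex.ofReal_mul, norm_mul,
    Complex.norm_real, Real.norm_of_nonneg (by positivity)]
  gcongr
  rw [← div_eq_mul_inv, div_le_iff₀ (by positivity)]
  have : ∑ i, inner ℝ ξ (e i) ^ 2 ≤ (∑ i, ‖e i‖ ^ 2) * ‖ξ‖ ^ 2 := by
    rw [Finset.sum_mul]
    refine Finset.sum_le_sum fun i _ => ?_
    rw [← mul_pow, ← sq_abs (inner ℝ ξ (e i)), mul_comm]
    gcongr
    exact abs_real_inner_le_norm _ _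
  have h2 : 0 ≤ ∑ i, ‖e i‖ ^ 2 := by positivity
  nlinarith [sq_nonneg ‖ξ‖]

end SobolevSlices

/-! ### Relative bounds with respect to `-Δ`. -/

section RelativeBounds

variable {X : Type*} [NormedAddCommGroup X] [InnerProductSpace ℝ X] [FiniteDimensional ℝ X]
  [MeasurableSpace X] [BorelSpace X]

theorem fourier_helmholtz_ae_eq {f g : L2 X} (h : (f, g) ∈ negLaplacianGraph X) :
    (𝓕 (f + ((((2 * Real.pi) ^ 2)⁻¹ : ℝ) : ℂ) • g) : L2 X) =ᵐ[volume]
      fun ξ => ((1 + ‖ξ‖ ^ 2 : ℝ) : ℂ) * (𝓕 f : L2 X) ξ := by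
  have h1 : (𝓕 (f + ((((2 * Real.pi) ^ 2)⁻¹ : ℝ) : ℂ) • g) : L2 X)
      = 𝓕 f + ((((2 * Real.pi) ^ 2)⁻¹ : ℝ) : ℂ) • 𝓕 g := by
    simp only [← FourierTransform.fourierCLM_apply (R := ℂ)]
    rw [map_add, map_smul]
  rw [h1]
  filter_upwards [fourier_ae_eq_of_mem_negLaplacianGraph h,
    Lp.coeFn_add (𝓕 f : L2 X) (((((2 * Real.pi) ^ 2)⁻¹ : ℝ) : ℂ) • 𝓕 g),
    Lp.coeFn_smul ((((2 * Real.pi) ^ 2)⁻¹ : ℝ) : ℂ) (𝓕 g : L2 X)] with ξ h2 h3 h4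
  have hpi : ((2 * Real.pi : ℝ) : ℂ) ≠ 0 := by
    exact_mod_cast (by positivity : (2 * Real.pi : ℝ) ≠ 0)
  rw [h3, Pi.add_apply, h4, Pi.smul_apply, h2, smul_eq_mul]
  push_cast at hpi ⊢
  field_simp

theorem norm_fourier_sub (f g : L2 X) : ‖(𝓕 f - 𝓕 g : L2 X)‖ = ‖f - g‖ := by
  rw [← Lp.norm_fourier_eq (f - g)]
  congr 1
  simp only [← FourierTransform.fourierCLM_apply (R := ℂ)]
  rw [map_sub]

/-- The inverse of `1 - (2π)⁻²Δ` is a contraction. Hence Schwartz approximations of `f + (2π)⁻²g`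
yield Schwartz approximations of `f`. -/
theorem norm_helmholtzInv_toLp_sub_le {f g : L2 X} (h : (f, g) ∈ negLaplacianGraph X)
    (w : 𝓢(X, ℂ)) :
    ‖(helmholtzInv w).toLp 2 volume - f‖ ≤
      ‖w.toLp 2 volume - (f + ((((2 * Real.pi) ^ 2)⁻¹ : ℝ) : ℂ) • g)‖ := by
  rw [← norm_fourier_sub, ← norm_fourier_sub (w.toLp 2 volume), SchwartzMap.toLp_fourier_eq,
    SchwartzMap.toLp_fourier_eq]
  have h0 := fourier_helmholtz_ae_eq h
  generalize (𝓕 (f + ((((2 * Real.pi) ^ 2)⁻¹ : ℝ) : ℂ) • g) : L2 X) = a at h0 ⊢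
  generalize (𝓕 f : L2 X) = b at h0 ⊢
  have h1 := fourier_helmholtzInv w
  generalize 𝓕 (helmholtzInv w) = u at h1 ⊢
  generalize 𝓕 w = v at h1 ⊢
  apply Lp.norm_le_norm_of_ae_le
  filter_upwards [h0, u.coeFn_toLp 2 volume, v.coeFn_toLp 2 volume,
    Lp.coeFn_sub (u.toLp 2 volume) b, Lp.coeFn_sub (v.toLp 2 volume) a] with ξ h2 h3 h4 h5 h6
  rw [h5, h6, Pi.sub_apply, Pi.sub_apply, h3, h4, h2, h1]
  have hpos : (0 : ℝ) < 1 + ‖ξ‖ ^ 2 := by positivity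
  have hne : ((1 + ‖ξ‖ ^ 2 : ℝ) : ℂ) ≠ 0 := by exact_mod_cast hpos.ne'
  have : (((1 + ‖ξ‖ ^ 2)⁻¹ : ℝ) : ℂ) * v ξ - b ξ =
      (((1 + ‖ξ‖ ^ 2)⁻¹ : ℝ) : ℂ) * (v ξ - ((1 + ‖ξ‖ ^ 2 : ℝ) : ℂ) * b ξ) := by
    rw [mul_sub, ← mul_assoc _ _ (b ξ), ← Complex.ofReal_mul, inv_mul_cancel₀ hpos.ne']
    simp
  rw [this, norm_mul, Complex.norm_real, Real.norm_of_nonneg (by positivity)]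
  exact mul_le_of_le_one_left (norm_nonneg _) (inv_le_one_of_one_le₀ (by nlinarith [sq_nonneg ‖ξ‖]))

/-- A square integrable function of a three-dimensional projection of `x` times a function in the
domain of `-Δ`. -/
theorem exists_eLpNorm_comp_mul_le {S : Type*} [NormedAddCommGroup S]
    [InnerProductSpace ℝ S] [FiniteDimensional ℝ S] [MeasurableSpace S] [BorelSpace S]
    (hS : Module.finrank ℝ S < 4) (L : X →L[ℝ] S) (hL : Function.Surjective L) :
    ∃ C : ℝ≥0∞, C ≠ ⊤ ∧ ∀ φ : S → ℝ, Measurable φ → MemLp φ 2 volume → ∀ f g : L2 X, (f, g) ∈ negLaplacianGraph X →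
      eLpNorm (fun x => (φ (L x) : ℂ) * f x) 2 volume ≤
        C * eLpNorm φ 2 volume * ‖f + ((((2 * Real.pi) ^ 2)⁻¹ : ℝ) : ℂ) • g‖ₑ := by
  obtain ⟨J₀, hJ₀⟩ := (L : X →ₗ[ℝ] S).exists_rightInverse_of_surjective
    (LinearMap.range_eq_top.mpr hL)
  let J : S →L[ℝ] X := J₀.toContinuousLinearMap
  have hJ : ∀ s, L (J s) = s := fun s => LinearMap.congr_fun hJ₀ s
  obtain ⟨K, hK, hKle⟩ := exists_eLpNorm_comp_mul_schwartz_le hS J hJ (stdOrthonormalBasis ℝ S)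
  obtain ⟨c, hc, hcle⟩ := exists_eLpNorm_helmholtz_helmholtzInv_le
    (fun i => J (stdOrthonormalBasis ℝ S i))
  refine ⟨K * c, ENNReal.mul_ne_top hK hc, fun φ hφ hφ2 f g hfg => ?_⟩
  have hd : DenseRange (SchwartzMap.toLpCLM ℝ ℂ 2 (volume : Measure X)) :=
    SchwartzMap.denseRange_toLpCLM (by norm_num)
  set a : L2 X := f + ((((2 * Real.pi) ^ 2)⁻¹ : ℝ) : ℂ) • g with ha
  obtain ⟨y, hy, hya⟩ := mem_closure_iff_seq_limit.mp (hd a)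
  choose w hw using hy
  have hwa : Tendsto (fun n => (w n).toLp 2 volume) atTop (𝓝 a) := by
    refine hya.congr fun n => ?_
    rw [← hw n, SchwartzMap.toLpCLM_apply]
  have hu : Tendsto (fun n => (helmholtzInv (w n)).toLp 2 volume) atTop (𝓝 f) := by
    rw [tendsto_iff_norm_sub_tendsto_zero] at hwa ⊢
    exact squeeze_zero (fun _ => norm_nonneg _)
      (fun n => norm_helmholtzInv_toLp_sub_le hfg (w n)) hwa
  -- Almost everywhere convergence along a subsequence permits Fatou, so `φ (L x) * f x` need not be
  -- known to lie in `L²` beforehand.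
  obtain ⟨ns, hns, hae⟩ := (tendstoInMeasure_of_tendsto_Lp hu).exists_seq_tendsto_ae
  have hLm : Measurable fun x => ((φ (L x) : ℝ) : ℂ) := by fun_prop
  have hlim : Tendsto (fun k => K * c * eLpNorm φ 2 volume * ‖(w (ns k)).toLp 2 volume‖ₑ) atTop
      (𝓝 (K * c * eLpNorm φ 2 volume * ‖a‖ₑ)) := by
    refine ENNReal.Tendsto.const_mul ?_
      (Or.inr (ENNReal.mul_ne_top (ENNReal.mul_ne_top hK hc) hφ2.2.ne))
    exact (continuous_enorm.tendsto a).comp (hwa.comp hns.tendsto_atTop)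
  calc eLpNorm (fun x => (φ (L x) : ℂ) * f x) 2 volume
      ≤ liminf (fun k => eLpNorm (fun x => (φ (L x) : ℂ) *
          (helmholtzInv (w (ns k))).toLp 2 volume x) 2 volume) atTop := by
        refine Lp.eLpNorm_lim_le_liminf_eLpNorm (fun k => ?_) _ ?_
        · exact hLm.aestronglyMeasurable.mul (Lp.aestronglyMeasurable _)
        · filter_upwards [hae] with x hx
          exact hx.const_mul _
    _ ≤ liminf (fun k => K * c * eLpNorm φ 2 volume * ‖(w (ns k)).toLp 2 volume‖ₑ) atTop := by
        refine liminf_le_liminf (.of_forall fun k => ?_)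
        generalize w (ns k) = v
        calc eLpNorm (fun x => (φ (L x) : ℂ) * (helmholtzInv v).toLp 2 volume x) 2 volume
            = eLpNorm (fun x => (φ (L x) : ℂ) * helmholtzInv v x) 2 volume := by
              refine eLpNorm_congr_ae ?_
              filter_upwards [(helmholtzInv v).coeFn_toLp 2 volume] with x hx
              rw [hx]
          _ ≤ K * eLpNorm φ 2 volume * (c * eLpNorm v 2 volume) := by
              refine (hKle φ hφ _).trans ?_
              gcongr
              exact hcle v
          _ = K * c * eLpNorm φ 2 volume * ‖v.toLp 2 volume‖ₑ := by
              rw [Lp.enorm_def, eLpNorm_congr_ae (v.coeFn_toLp 2 volume)]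
              ring
    _ = _ := hlim.liminf_eq

/-- The image of Lebesgue measure is a multiple, possibly infinite, of Lebesgue measure. Null sets
therefore pull back to null sets, so almost everywhere statements about pair potentials lift to
configuration space. -/
theorem quasiMeasurePreserving_of_surjective {S : Type*} [NormedAddCommGroup S]
    [InnerProductSpace ℝ S] [FiniteDimensional ℝ S] [MeasurableSpace S] [BorelSpace S]
    (L : X →L[ℝ] S) (hL : Function.Surjective L) :
    Measure.QuasiMeasurePreserving L (volume : Measure X) (volume : Measure S) := by
  refine ⟨L.measurable, ?_⟩
  obtain ⟨c, -, hc⟩ := (L : X →ₗ[ℝ] S).exists_map_addHaar_eq_smul_addHaar volume volume hL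
  change Measure.map L volume = _ at hc
  rw [hc]
  exact Measure.smul_absolutelyContinuous

/-- Multiplication by `W` is relatively bounded with respect to `-Δ`, with relative bound zero. -/
def RelativelySmall (W : X → ℝ) : Prop :=
  AEStronglyMeasurable W volume ∧ ∀ ε : ℝ, 0 < ε → ∃ B : ℝ, 0 ≤ B ∧
    ∀ f g : L2 X, (f, g) ∈ negLaplacianGraph X →
      eLpNorm (fun x => (W x : ℂ) * f x) 2 volume ≤ ENNReal.ofReal (ε * ‖g‖ + B * ‖f‖)

theorem aestronglyMeasurable_ofReal_mul {W : X → ℝ} (hW : AEStronglyMeasurable W volume)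
    (f : L2 X) : AEStronglyMeasurable (fun x => (W x : ℂ) * f x) volume :=
  (Complex.continuous_ofReal.comp_aestronglyMeasurable hW).mul (Lp.aestronglyMeasurable f)

theorem RelativelySmall.zero : RelativelySmall (0 : X → ℝ) := by
  refine ⟨aestronglyMeasurable_const, fun ε hε => ⟨0, le_rfl, fun f g _ => ?_⟩⟩
  simp

theorem RelativelySmall.add {W₁ W₂ : X → ℝ} (h₁ : RelativelySmall W₁) (h₂ : RelativelySmall W₂) :
    RelativelySmall (W₁ + W₂) := by
  refine ⟨h₁.1.add h₂.1, fun ε hε => ?_⟩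
  obtain ⟨B₁, hB₁, hle₁⟩ := h₁.2 (ε / 2) (half_pos hε)
  obtain ⟨B₂, hB₂, hle₂⟩ := h₂.2 (ε / 2) (half_pos hε)
  refine ⟨B₁ + B₂, add_nonneg hB₁ hB₂, fun f g hfg => ?_⟩
  have e : (fun x => ((W₁ + W₂) x : ℂ) * f x)
      = (fun x => (W₁ x : ℂ) * f x) + fun x => (W₂ x : ℂ) * f x := by
    ext x; simp [add_mul]
  have e2 : ε * ‖g‖ + (B₁ + B₂) * ‖f‖
      = (ε / 2 * ‖g‖ + B₁ * ‖f‖) + (ε / 2 * ‖g‖ + B₂ * ‖f‖) := by ring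
  rw [e, e2, ENNReal.ofReal_add (by positivity) (by positivity)]
  exact (eLpNorm_add_le (aestronglyMeasurable_ofReal_mul h₁.1 f)
    (aestronglyMeasurable_ofReal_mul h₂.1 f) (by norm_num)).trans
    (add_le_add (hle₁ f g hfg) (hle₂ f g hfg))

theorem RelativelySmall.sum {ι : Type*} (s : Finset ι) {W : ι → X → ℝ}
    (h : ∀ i ∈ s, RelativelySmall (W i)) : RelativelySmall (∑ i ∈ s, W i) :=
  Finset.sum_induction W RelativelySmall (fun _ _ => RelativelySmall.add) RelativelySmall.zero h

theorem RelativelySmall.of_bounded {W : X → ℝ} (hW : AEStronglyMeasurable W volume) {C : ℝ}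
    (hC : ∀ x, |W x| ≤ C) : RelativelySmall W := by
  refine ⟨hW, fun ε hε => ⟨C, (abs_nonneg _).trans (hC 0), fun f g _ => ?_⟩⟩
  have hC0 : 0 ≤ C := (abs_nonneg _).trans (hC 0)
  calc eLpNorm (fun x => (W x : ℂ) * f x) 2 volume
      ≤ ENNReal.ofReal C * eLpNorm f 2 volume := by
        refine eLpNorm_le_mul_eLpNorm_of_ae_le_mul (.of_forall fun x => ?_) 2
        rw [norm_mul, Complex.norm_real, Real.norm_eq_abs]
        gcongr
        exact hC x
    _ = ENNReal.ofReal (C * ‖f‖) := by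
        rw [ENNReal.ofReal_mul hC0, ofReal_norm, Lp.enorm_def]
    _ ≤ _ := by
        apply ENNReal.ofReal_le_ofReal
        have : 0 ≤ ε * ‖g‖ := by positivity
        linarith

/-- Bounded continuous functions are dense in `L²`: the remainder of small norm costs a small
multiple of `‖f‖ + ‖g‖`, and the bounded part costs a multiple of `‖f‖` alone up to any `ε‖g‖`. -/
theorem RelativelySmall.comp_memLp_two {S : Type*} [NormedAddCommGroup S]
    [InnerProductSpace ℝ S] [FiniteDimensional ℝ S] [MeasurableSpace S] [BorelSpace S]
    (hS : Module.finrank ℝ S < 4) (L : X →L[ℝ] S) (hL : Function.Surjective L)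
    {φ : S → ℝ} (hφ : MemLp φ 2 volume) : RelativelySmall fun x => φ (L x) := by
  have hq := quasiMeasurePreserving_of_surjective L hL
  obtain ⟨C, hC, hle⟩ := exists_eLpNorm_comp_mul_le hS L hL
  refine ⟨hφ.1.comp_quasiMeasurePreserving hq, fun ε hε => ?_⟩
  obtain ⟨δ, hδ, hδle⟩ : ∃ δ : ℝ≥0∞, δ ≠ 0 ∧ C * δ ≤ ENNReal.ofReal (ε / 2) := by
    refine ⟨ENNReal.ofReal (ε / 2) / C, ?_, ENNReal.mul_div_le⟩
    exact (ENNReal.div_pos (by simpa using hε) hC).ne'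
  obtain ⟨ψ, hψ, hψ2⟩ := hφ.exists_boundedContinuous_eLpNorm_sub_le (by norm_num) hδ
  have hψL : Continuous fun x => ψ (L x) := by fun_prop
  obtain ⟨B, hB, hBle⟩ := (RelativelySmall.of_bounded (W := fun x => ψ (L x))
    hψL.aestronglyMeasurable (fun x => ψ.norm_coe_le_norm (L x))).2 (ε / 2) (half_pos hε)
  have hφψ := hφ.sub hψ2
  -- The slice estimate needs a measurable function, hence a representative of `φ - ψ`.
  obtain ⟨η, hηm, hη⟩ := hφψ.1.aemeasurable
  have hη2 : MemLp η 2 volume := (memLp_congr_ae hη).mp hφψ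
  have hηδ : eLpNorm η 2 volume ≤ δ := (eLpNorm_congr_ae hη).symm.trans_le hψ
  refine ⟨ε / 2 + B, by positivity, fun f g hfg => ?_⟩
  have e2 : ε * ‖g‖ + (ε / 2 + B) * ‖f‖
      = ε / 2 * (‖f‖ + ‖g‖) + (ε / 2 * ‖g‖ + B * ‖f‖) := by ring
  have e : (fun x => (φ (L x) : ℂ) * f x) =ᵐ[volume]
      (fun x => (η (L x) : ℂ) * f x) + fun x => (ψ (L x) : ℂ) * f x := by
    filter_upwards [hq.ae hη] with x hx
    simp only [Pi.add_apply, ← hx, Pi.sub_apply]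
    push_cast
    ring
  have hpi : ‖((((2 * Real.pi) ^ 2)⁻¹ : ℝ) : ℂ)‖ ≤ 1 := by
    rw [Complex.norm_real, Real.norm_of_nonneg (by positivity)]
    apply inv_le_one_of_one_le₀
    nlinarith [Real.pi_gt_three]
  rw [e2, ENNReal.ofReal_add (by positivity) (by positivity), eLpNorm_congr_ae e]
  refine (eLpNorm_add_le (aestronglyMeasurable_ofReal_mul (hηm.comp L.measurable).aestronglyMeasurable f)
    (aestronglyMeasurable_ofReal_mul hψL.aestronglyMeasurable f) (by norm_num)).trans
    (add_le_add ?_ (hBle f g hfg))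
  refine (hle η hηm hη2 f g hfg).trans ?_
  rw [ENNReal.ofReal_mul (by positivity)]
  refine mul_le_mul' ((mul_le_mul' le_rfl hηδ).trans hδle) ?_
  rw [← ofReal_norm]
  apply ENNReal.ofReal_le_ofReal
  refine (norm_add_le _ _).trans ?_
  rw [norm_smul]
  have := mul_le_of_le_one_left (norm_nonneg g) hpi
  linarith

theorem RelativelySmall.comp_memL2AddLinfty (L : X →L[ℝ] Space) (hL : Function.Surjective L)
    {F : Space → ℝ} (hF : MemL2AddLinfty F) : RelativelySmall fun x => F (L x) := by
  obtain ⟨φ, ψ, rfl, hφ, hψ, ⟨C, hC⟩, -⟩ := hF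
  exact (RelativelySmall.comp_memLp_two (by simp) L hL hφ).add
    (RelativelySmall.of_bounded (W := fun x => ψ (L x))
      (hψ.comp L.measurable).aestronglyMeasurable fun x => hC _)

end RelativeBounds

/-! ### Rellich's theorem by frequency truncation. -/

section LocalCompactness

variable {X : Type*} [NormedAddCommGroup X] [InnerProductSpace ℝ X] [FiniteDimensional ℝ X]
  [MeasurableSpace X] [BorelSpace X]

/-- The part of an `L²` function carried by a ball. -/
def truncate (K : ℝ) (f : L2 X) : L2 X :=
  ((Lp.memLp f).indicator (Metric.isClosed_closedBall (x := (0 : X)) (ε := K)).measurableSet).toLp _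

theorem coeFn_truncate (K : ℝ) (f : L2 X) :
    truncate K f =ᵐ[volume] (Metric.closedBall (0 : X) K).indicator f :=
  MemLp.coeFn_toLp _

theorem integrable_truncate (K : ℝ) (f : L2 X) : Integrable (truncate K f) volume := by
  refine Integrable.congr ?_ (coeFn_truncate K f).symm
  rw [integrable_indicator_iff Metric.isClosed_closedBall.measurableSet]
  exact (locallyIntegrable_of_memLp_two (Lp.memLp f)).integrableOn_isCompact
    (isCompact_closedBall _ _)

/-- The truncated plane wave `ξ ↦ χ_{|ξ| ≤ K} exp(-2πi⟨ξ, x⟩)`. -/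
def planeWave (K : ℝ) (x : X) : L2 X :=
  MemLp.toLp ((Metric.closedBall (0 : X) K).indicator
    fun ξ => ((Real.fourierChar (-inner ℝ ξ x) : Circle) : ℂ)) (by
      rw [memLp_indicator_iff_restrict Metric.isClosed_closedBall.measurableSet]
      have : IsFiniteMeasure (volume.restrict (Metric.closedBall (0 : X) K)) :=
        ⟨by simpa using measure_closedBall_lt_top⟩
      refine MemLp.of_bound (Continuous.aestronglyMeasurable ?_) 1 
        (.of_forall fun ξ => (Circle.norm_coe _).le)
      exact continuous_induced_dom.comp (Real.continuous_fourierChar.comp (by fun_prop)))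

theorem coeFn_planeWave (K : ℝ) (x : X) :
    planeWave K x =ᵐ[volume] (Metric.closedBall (0 : X) K).indicator
      fun ξ => ((Real.fourierChar (-inner ℝ ξ x) : Circle) : ℂ) :=
  MemLp.coeFn_toLp _

theorem norm_planeWave_le (K : ℝ) (x : X) :
    ‖planeWave K x‖ ≤ ‖planeWave K (0 : X)‖ := by
  apply Lp.norm_le_norm_of_ae_le
  filter_upwards [coeFn_planeWave K x, coeFn_planeWave K (0 : X)] with ξ h1 h2
  rw [h1, h2, norm_indicator_eq_indicator_norm, norm_indicator_eq_indicator_norm]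
  simp only [Circle.norm_coe, le_refl]

/-- Point values of a band-limited function are inner products, so weak convergence controls them
pointwise. -/
theorem fourierInv_truncate_apply (K : ℝ) (f : L2 X) (x : X) :
    𝓕⁻ (truncate K f : X → ℂ) x = inner ℂ (planeWave K x) f := by
  rw [Real.fourierInv_eq, L2.inner_def]
  refine integral_congr_ae ?_
  filter_upwards [coeFn_truncate K f, coeFn_planeWave K x] with ξ h1 h2
  rw [h1, h2]
  by_cases h : ξ ∈ Metric.closedBall (0 : X) K
  · simp only [Set.indicator_of_mem h, RCLike.inner_apply, Circle.smul_def, smul_eq_mul,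
      AddChar.map_neg_eq_inv, Circle.coe_inv_eq_conj, Complex.conj_conj]
    ring
  · simp [Set.indicator_of_notMem h]

/-- Beyond radius `K` the symbol exceeds `1 + K²`, which makes the high frequencies uniformly small
on graph-norm bounded sets. -/
theorem norm_sub_truncate_fourier_le {f g : L2 X} (h : (f, g) ∈ negLaplacianGraph X) {K : ℝ}
    (hK : 0 ≤ K) : ‖(𝓕 f - truncate K (𝓕 f) : L2 X)‖ ≤
      (1 + K ^ 2)⁻¹ * ‖f + ((((2 * Real.pi) ^ 2)⁻¹ : ℝ) : ℂ) • g‖ := by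
  rw [← Lp.norm_fourier_eq (f + _)]
  apply Lp.norm_le_mul_norm_of_ae_le_mul
  filter_upwards [fourier_helmholtz_ae_eq h, coeFn_truncate K (𝓕 f : L2 X),
    Lp.coeFn_sub (𝓕 f : L2 X) (truncate K (𝓕 f))] with ξ h1 h2 h3
  rw [h1, h3, Pi.sub_apply, h2, norm_mul, Complex.norm_real, Real.norm_of_nonneg (by positivity),
    ← mul_assoc]
  by_cases hξ : ξ ∈ Metric.closedBall (0 : X) K
  · rw [Set.indicator_of_mem hξ, sub_self, norm_zero]
    positivity
  · rw [Set.indicator_of_notMem hξ, sub_zero]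
    have : K < ‖ξ‖ := by simpa using hξ
    refine le_mul_of_one_le_left (norm_nonneg _) ?_
    rw [← div_eq_inv_mul, one_le_div (by positivity)]
    gcongr

/-- Dominated convergence on the ball: the low-frequency parts tend to zero pointwise and are
bounded by `‖planeWave K 0‖ * M`. -/
theorem tendsto_fourierInv_truncate_eLpNorm {f : ℕ → L2 X} {M : ℝ} (hM : ∀ n, ‖f n‖ ≤ M)
    (hf : ∀ φ : L2 X, Tendsto (fun n => inner ℂ φ (f n)) atTop (𝓝 0)) (K R : ℝ) :
    Tendsto (fun n => eLpNorm ((Metric.closedBall (0 : X) R).indicator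
      (𝓕⁻ (truncate K (𝓕 (f n))) : L2 X)) 2 volume) atTop (𝓝 0) := by
  have hsq : Tendsto (fun n => eLpNorm ((Metric.closedBall (0 : X) R).indicator
      (𝓕⁻ (truncate K (𝓕 (f n))) : L2 X)) 2 volume ^ 2) atTop (𝓝 0) := by
    simp only [eLpNorm_two_sq]
    rw [← lintegral_zero (μ := (volume : Measure X))]
    have hae : ∀ n, ∀ᵐ x : X, (𝓕⁻ (truncate K (𝓕 (f n))) : L2 X) x
        = inner ℂ (𝓕⁻ (planeWave K x) : L2 X) (f n) := by
      intro n
      filter_upwards [fourierInv_ae_eq_of_integrable (truncate K (𝓕 (f n)))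
        (integrable_truncate K (𝓕 (f n)))] with x hx
      rw [hx, fourierInv_truncate_apply, ← Lp.inner_fourier_eq (𝓕⁻ (planeWave K x) : L2 X),
        FourierTransform.fourier_fourierInv_eq]
    refine tendsto_lintegral_of_dominated_convergence'
      ((Metric.closedBall (0 : X) R).indicator fun _ =>
        ENNReal.ofReal (‖planeWave K (0 : X)‖ * M) ^ 2) (fun n => ?_) (fun n => ?_) ?_ ?_
    · exact ((Lp.aestronglyMeasurable _).indicator
        Metric.isClosed_closedBall.measurableSet).enorm.pow_const 2
    · filter_upwards [hae n] with x hx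
      by_cases h : x ∈ Metric.closedBall (0 : X) R
      · rw [Set.indicator_of_mem h, Set.indicator_of_mem h, hx, ← ofReal_norm]
        gcongr
        refine (norm_inner_le_norm _ _).trans ?_
        have h1 : ‖(𝓕⁻ (planeWave K x) : L2 X)‖ = ‖planeWave K x‖ := by
          rw [← Lp.norm_fourier_eq, FourierTransform.fourier_fourierInv_eq]
        rw [h1]
        exact mul_le_mul (norm_planeWave_le K x) (hM n) (norm_nonneg _) (norm_nonneg _)
      · simp [Set.indicator_of_notMem h]
    · rw [lintegral_indicator_const Metric.isClosed_closedBall.measurableSet]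
      exact ENNReal.mul_ne_top (ENNReal.pow_ne_top ENNReal.ofReal_ne_top) measure_closedBall_lt_top.ne
    · filter_upwards [ae_all_iff.mpr hae] with x hx
      by_cases h : x ∈ Metric.closedBall (0 : X) R
      · simp only [Set.indicator_of_mem h, hx]
        have h1 := (hf (𝓕⁻ (planeWave K x))).enorm
        have h2 := ENNReal.Tendsto.pow h1 (n := 2)
        simpa using h2
      · simp [Set.indicator_of_notMem h]
  have h2 := (ENNReal.continuous_rpow_const (y := (1 / 2 : ℝ))).tendsto 0 |>.comp hsq
  rw [ENNReal.zero_rpow_of_pos (by norm_num)] at h2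
  refine h2.congr fun n => ?_
  simp only [Function.comp_apply]
  rw [← ENNReal.rpow_natCast, ← ENNReal.rpow_mul]
  norm_num

/-- Rellich's theorem: sequences bounded in the domain of `-Δ` that tend to zero weakly in `L²`
tend to zero in `L²` of every ball. -/
theorem totallySpreading_of_tendsto_inner_zero {f g : ℕ → L2 X}
    (hfg : ∀ n, (f n, g n) ∈ negLaplacianGraph X) {M M' : ℝ} (hM : ∀ n, ‖f n‖ ≤ M)
    (hM' : ∀ n, ‖g n‖ ≤ M')
    (hf : ∀ φ : L2 X, Tendsto (fun n => inner ℂ φ (f n)) atTop (𝓝 0)) : TotallySpreading f := by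
  intro R _
  set c : ℂ := ((((2 * Real.pi) ^ 2)⁻¹ : ℝ) : ℂ) with hc
  have hw : ∀ n, ‖f n + c • g n‖ ≤ M + ‖c‖ * M' := fun n => by
    refine (norm_add_le _ _).trans ?_
    rw [norm_smul]
    gcongr
    exacts [hM n, hM' n]
  set A := M + ‖c‖ * M' with hA
  have hA0 : 0 ≤ A := (norm_nonneg _).trans (hw 0)
  rw [ENNReal.tendsto_atTop_zero]
  intro ε hε
  have hlimK : Tendsto (fun K : ℝ => ENNReal.ofReal ((1 + K ^ 2)⁻¹ * A)) atTop (𝓝 0) := by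
    rw [← ENNReal.ofReal_zero]
    refine (ENNReal.continuous_ofReal.tendsto 0).comp ?_
    rw [← zero_mul A]
    refine Tendsto.mul_const _ (tendsto_inv_atTop_zero.comp ?_)
    exact tendsto_atTop_add_const_left _ _ (tendsto_pow_atTop two_ne_zero)
  -- The cutoff `K` is fixed first, making the high-frequency tail at most `ε / 2` for every `n`;
  -- only then is `n` taken large.
  obtain ⟨K, hKε, hK⟩ := ((hlimK.eventually_le_const (ENNReal.half_pos hε.ne')).and
    (eventually_ge_atTop 0)).exists
  obtain ⟨n₀, hn₀⟩ := ENNReal.tendsto_atTop_zero.mp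
    (tendsto_fourierInv_truncate_eLpNorm hM hf K R) (ε / 2) (ENNReal.half_pos hε.ne')
  refine ⟨n₀, fun n hn => ?_⟩
  set p : L2 X := 𝓕⁻ (truncate K (𝓕 (f n))) with hp
  have hq : ‖f n - p‖ ≤ (1 + K ^ 2)⁻¹ * A := by
    rw [← norm_fourier_sub, hp, FourierTransform.fourier_fourierInv_eq]
    refine (norm_sub_truncate_fourier_le (hfg n) hK).trans ?_
    gcongr
    exact hw n
  have hsplit : (Metric.closedBall (0 : X) R).indicator (f n) =ᵐ[volume]
      (Metric.closedBall (0 : X) R).indicator p +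
        (Metric.closedBall (0 : X) R).indicator (f n - p : L2 X) := by
    filter_upwards [Lp.coeFn_sub (f n) p] with x hx
    by_cases h : x ∈ Metric.closedBall (0 : X) R
    · rw [Pi.add_apply, Set.indicator_of_mem h, Set.indicator_of_mem h, Set.indicator_of_mem h,
        hx, Pi.sub_apply]
      ring
    · simp [Set.indicator_of_notMem h]
  have hms : MeasurableSet (Metric.closedBall (0 : X) R) :=
    Metric.isClosed_closedBall.measurableSet
  rw [eLpNorm_congr_ae hsplit, ← ENNReal.add_halves ε]
  refine (eLpNorm_add_le ((Lp.aestronglyMeasurable _).indicator hms)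
    ((Lp.aestronglyMeasurable _).indicator hms) (by norm_num)).trans
    (add_le_add (hn₀ n hn) ((eLpNorm_indicator_le _).trans ?_))
  rw [← Lp.enorm_def, ← ofReal_norm]
  exact (ENNReal.ofReal_le_ofReal hq).trans hKε

end LocalCompactness

/-! ### Weak sequential compactness in Hilbert space. -/

theorem exists_subseq_tendsto_inner {H : Type*} [NormedAddCommGroup H] [InnerProductSpace ℂ H]
    [CompleteSpace H] [TopologicalSpace.SeparableSpace H] {x : ℕ → H} {M : ℝ}
    (hx : ∀ n, ‖x n‖ ≤ M) :
    ∃ (a : H) (θ : ℕ → ℕ), StrictMono θ ∧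
      ∀ v, Tendsto (fun n => inner ℂ v (x (θ n))) atTop (𝓝 (inner ℂ v a)) := by
  -- Sequential Banach–Alaoglu through the Riesz map. The functional is `v ↦ ⟨x n, v⟩`, hence the
  -- conjugations below.
  let y : ℕ → WeakDual ℂ H := fun n => StrongDual.toWeakDual (InnerProductSpace.toDual ℂ H (x n))
  obtain ⟨b, -, θ, hθ, hb⟩ := WeakDual.isSeqCompact_closedBall ℂ H 0 M (x := y) (fun n => by
    simpa [y] using hx n)
  refine ⟨(InnerProductSpace.toDual ℂ H).symm (WeakDual.toStrongDual b), θ, hθ, fun v => ?_⟩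
  have h1 : Tendsto (fun n => y (θ n) v) atTop (𝓝 (b v)) :=
    ((WeakDual.eval_continuous v).tendsto b).comp hb
  rw [← inner_conj_symm, InnerProductSpace.toDual_symm_apply]
  have h2 := (Complex.continuous_conj.tendsto _).comp h1
  refine h2.congr fun n => ?_
  rw [← inner_conj_symm]
  rfl

theorem tendsto_inner_of_tendsto {H : Type*} [NormedAddCommGroup H] [InnerProductSpace ℂ H]
    {u x : ℕ → H} {v a : H} {M : ℝ} (hu : Tendsto u atTop (𝓝 v)) (hM : ∀ n, ‖x n‖ ≤ M)
    (hx : Tendsto (fun n => inner ℂ v (x n)) atTop (𝓝 (inner ℂ v a))) :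
    Tendsto (fun n => inner ℂ (u n) (x n)) atTop (𝓝 (inner ℂ v a)) := by
  have h : Tendsto (fun n => inner ℂ (u n - v) (x n)) atTop (𝓝 0) := by
    refine squeeze_zero_norm (a := fun n => ‖u n - v‖ * M) (fun n => ?_) ?_
    · exact (norm_inner_le_norm _ _).trans (by gcongr; exact hM n)
    · simpa using (tendsto_iff_norm_sub_tendsto_zero.mp hu).mul_const M
  have := h.add hx
  simpa [inner_sub_left] using this

/-! ### Pair potentials on the centred configuration space. -/

section Particles

variable {N : ℕ}

/-- The relative position `r i - r j` as a linear function on configuration space. -/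
def relativePosition (ℏ : ℝ) (m : Fin N → ℝ) (i j : Fin N) : RelSpace m →L[ℝ] Space :=
  LinearMap.toContinuousLinearMap
    { toFun := fun x => position ℏ m x i - position ℏ m x j
      map_add' := fun x y => by
        have h : ∀ k, position ℏ m (x + y) k = position ℏ m x k + position ℏ m y k := fun k =>
          smul_add (ℏ / √(2 * m k)) ((x : centredSubspace m).1 k) ((y : centredSubspace m).1 k)
        rw [h, h]
        abel
      map_smul' := fun c x => by
        have h : ∀ k, position ℏ m (c • x) k = c • position ℏ m x k := fun k =>
          smul_comm (ℏ / √(2 * m k)) c ((x : centredSubspace m).1 k)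
        rw [h, h, RingHom.id_apply, smul_sub] }

@[simp]
theorem relativePosition_apply (ℏ : ℝ) (m : Fin N → ℝ) (i j : Fin N) (x : RelSpace m) :
    relativePosition ℏ m i j x = position ℏ m x i - position ℏ m x j :=
  rfl

theorem relativePosition_surjective {ℏ : ℝ} (hℏ : 0 < ℏ) {m : Fin N → ℝ} (hm : ∀ i, 0 < m i)
    {i j : Fin N} (hij : i ≠ j) : Function.Surjective (relativePosition ℏ m i j) := by
  intro d
  set κ : ℝ := ℏ / √(2 * m i) * √(m j) + ℏ / √(2 * m j) * √(m i) with hκ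
  have hi := hm i
  have hj := hm j
  have hκ0 : 0 < κ := by positivity
  -- Only particles `i` and `j` move, in opposite directions. The weights `√(m j)` and `√(m i)`
  -- cancel in the centre-of-mass condition, and `κ` normalises the relative position to `d`.
  let x₀ : PiLp 2 fun _ : Fin N => Space := WithLp.toLp 2 fun k =>
    if k = i then (√(m j) / κ) • d else if k = j then -((√(m i) / κ) • d) else 0
  have hxi : x₀ i = (√(m j) / κ) • d := by simp [x₀]
  have hxj : x₀ j = -((√(m i) / κ) • d) := by simp [x₀, hij.symm]
  have hx₀ : x₀ ∈ centredSubspace m := by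
    change ∑ k, √(m k) • x₀ k = 0
    rw [← Finset.sum_subset (Finset.subset_univ {i, j}) (fun k _ hk => by
      simp only [Finset.mem_insert, Finset.mem_singleton, not_or] at hk
      simp [x₀, hk.1, hk.2]), Finset.sum_pair hij, hxi, hxj, smul_neg, smul_smul, smul_smul,
      ← sub_eq_add_neg, ← sub_smul]
    rw [show √(m i) * (√(m j) / κ) - √(m j) * (√(m i) / κ) = 0 by ring, zero_smul]
  refine ⟨(⟨x₀, hx₀⟩ : centredSubspace m), ?_⟩
  change (ℏ / √(2 * m i)) • x₀ i - (ℏ / √(2 * m j)) • x₀ j = d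
  rw [hxi, hxj, smul_neg, sub_neg_eq_add, smul_smul, smul_smul, ← add_smul]
  rw [show ℏ / √(2 * m i) * (√(m j) / κ) + ℏ / √(2 * m j) * (√(m i) / κ) = κ / κ by
    rw [hκ]; ring, div_self hκ0.ne', one_smul]

theorem totalPotential_eq_sum (ℏ : ℝ) (m : Fin N → ℝ) (V : Fin N → Fin N → Space → ℝ) :
    totalPotential ℏ m V =
      ∑ i, ∑ j ∈ Finset.Ioi i, fun x => V i j (relativePosition ℏ m i j x) := by
  ext x
  simp [totalPotential]

theorem relativelySmall_totalPotential {ℏ : ℝ} (hℏ : 0 < ℏ) {m : Fin N → ℝ} (hm : ∀ i, 0 < m i)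
    {V : Fin N → Fin N → Space → ℝ} (hV : ∀ i j, i < j → MemL2AddLinfty (V i j)) :
    RelativelySmall (totalPotential ℏ m V) := by
  rw [totalPotential_eq_sum]
  refine RelativelySmall.sum _ fun i _ => RelativelySmall.sum _ fun j hj => ?_
  have hij := Finset.mem_Ioi.mp hj
  exact RelativelySmall.comp_memL2AddLinfty _ (relativePosition_surjective hℏ hm hij.ne)
    (hV i j hij)

theorem abs_totalPotential_le_ae {ℏ : ℝ} (hℏ : 0 < ℏ) {m : Fin N → ℝ} (hm : ∀ i, 0 < m i)
    {V W : Fin N → Fin N → Space → ℝ} (hV : ∀ i j, i < j → ∀ᵐ y, |V i j y| ≤ W i j y) :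
    ∀ᵐ x : RelSpace m, |totalPotential ℏ m V x| ≤ totalPotential ℏ m W x := by
  have h : ∀ i j, i < j → ∀ᵐ x : RelSpace m, |V i j (relativePosition ℏ m i j x)| ≤
      W i j (relativePosition ℏ m i j x) := fun i j hij =>
    (quasiMeasurePreserving_of_surjective _
      (relativePosition_surjective hℏ hm hij.ne)).ae (hV i j hij)
  have h' : ∀ᵐ x : RelSpace m, ∀ i j, i < j → |V i j (relativePosition ℏ m i j x)| ≤
      W i j (relativePosition ℏ m i j x) := by
    simp only [ae_all_iff]
    exact h
  filter_upwards [h'] with x hx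
  refine (Finset.abs_sum_le_sum_abs _ _).trans (Finset.sum_le_sum fun i _ => ?_)
  refine (Finset.abs_sum_le_sum_abs _ _).trans (Finset.sum_le_sum fun j hj => ?_)
  exact hx i j (Finset.mem_Ioi.mp hj)

/-- Separates the kinetic and potential terms, whose weak limits are identified by different
arguments. -/
theorem hamiltonian_eq_smul_iff {ℏ : ℝ} {m : Fin N → ℝ} {V : Fin N → Fin N → Space → ℝ}
    {f : L2 (RelSpace m)} {z : ℂ} :
    (∃ h : f ∈ (hamiltonian ℏ m V).domain, hamiltonian ℏ m V ⟨f, h⟩ = z • f) ↔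
      ∃ g k : L2 (RelSpace m), (f, g) ∈ negLaplacianGraph (RelSpace m) ∧
        (k =ᵐ[volume] fun x => (totalPotential ℏ m V x : ℂ) * f x) ∧ g + k = z • f := by
  constructor
  · rintro ⟨h, he⟩
    refine ⟨kinetic m ⟨f, h.1⟩, mulOperator (totalPotential ℏ m V) ⟨f, h.2⟩, ?_, ?_, ?_⟩
    · exact (negLaplacian_spec _ _ _).mp ⟨h.1, rfl⟩
    · exact (mulOperator_spec _ _ _).mp ⟨h.2, rfl⟩
    · rw [← he]
      rfl
  · rintro ⟨g, k, hg, hk, he⟩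
    obtain ⟨h1, rfl⟩ := (negLaplacian_spec _ f g).mpr hg
    obtain ⟨h2, rfl⟩ := (mulOperator_spec _ f k).mpr hk
    exact ⟨⟨h1, h2⟩, he⟩

end Particles

/-! ### Passage to the limit in the eigenvalue equation. -/

section WeakLimits

variable {X : Type*} [NormedAddCommGroup X] [InnerProductSpace ℝ X] [FiniteDimensional ℝ X]
  [MeasurableSpace X] [BorelSpace X]

theorem RelativelySmall.memLp {W : X → ℝ} (hW : RelativelySmall W) {f g : L2 X}
    (hfg : (f, g) ∈ negLaplacianGraph X) : MemLp (fun x => (W x : ℂ) * f x) 2 volume := by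
  obtain ⟨B, -, hle⟩ := hW.2 1 one_pos
  exact ⟨aestronglyMeasurable_ofReal_mul hW.1 f, (hle f g hfg).trans_lt ENNReal.ofReal_lt_top⟩

theorem RelativelySmall.memLp_schwartz {W : X → ℝ} (hW : RelativelySmall W) (u : 𝓢(X, ℂ)) :
    MemLp (fun x => (W x : ℂ) * u x) 2 volume := by
  refine (memLp_congr_ae ?_).mp (hW.memLp (schwartz_mem_negLaplacianGraph u))
  filter_upwards [u.coeFn_toLp 2 volume] with x hx
  rw [hx]

/-- The graph of `-Δ` is weakly closed. -/
theorem mem_negLaplacianGraph_of_tendsto_inner {f g : ℕ → L2 X} {f₀ g₀ : L2 X}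
    (hfg : ∀ n, (f n, g n) ∈ negLaplacianGraph X)
    (hf : ∀ v, Tendsto (fun n => inner ℂ v (f n)) atTop (𝓝 (inner ℂ v f₀)))
    (hg : ∀ v, Tendsto (fun n => inner ℂ v (g n)) atTop (𝓝 (inner ℂ v g₀))) :
    (f₀, g₀) ∈ negLaplacianGraph X := by
  -- The distributional pairing is bilinear and the inner product sesquilinear, hence the `star`.
  have key : ∀ (u : 𝓢(X, ℂ)) (h : L2 X), (h : 𝓢'(X, ℂ)) u =
      inner ℂ (star (u.toLp 2 volume)) h := by
    intro u h
    rw [Lp.toTemperedDistribution_apply, L2.inner_def]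
    refine integral_congr_ae ?_
    filter_upwards [u.coeFn_toLp 2 volume, Lp.coeFn_star (u.toLp 2 volume)] with x h1 h2
    rw [h2, Pi.star_apply, h1, RCLike.inner_apply, smul_eq_mul]
    simp [mul_comm]
  rw [mem_negLaplacianGraph_iff]
  ext u
  have h1 : ∀ n, ((g n : L2 X) : 𝓢'(X, ℂ)) u = -((f n : L2 X) : 𝓢'(X, ℂ)) (Δ u) := fun n => by
    have := congrArg (fun T : 𝓢'(X, ℂ) => T u) (mem_negLaplacianGraph_iff.mp (hfg n))
    simpa only [neg_apply, TemperedDistribution.laplacian_apply_apply] using this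
  have h2 : (g₀ : 𝓢'(X, ℂ)) u = -(f₀ : 𝓢'(X, ℂ)) (Δ u) := by
    simp only [key] at h1 ⊢
    refine tendsto_nhds_unique (hg _) ?_
    simp only [h1]
    exact (hf _).neg
  simpa only [neg_apply, TemperedDistribution.laplacian_apply_apply] using h2

/-- Eigenfunctions for dominated, converging potentials that do not spread totally have, along a
subsequence, a nonzero weak limit, which is an eigenfunction for the limiting potential. -/
theorem exists_eigenfunction_of_not_totallySpreading {G W₀ : X → ℝ} {W : ℕ → X → ℝ}
    (hG : RelativelySmall G) (hW₀ : RelativelySmall W₀) (hW : ∀ n, RelativelySmall (W n))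
    (hWG : ∀ n, ∀ᵐ x, |W n x| ≤ G x)
    (hlim : ∀ f : X → ℂ, ContDiff ℝ ∞ f → HasCompactSupport f →
      Tendsto (fun n => eLpNorm (fun x => ((W n x - W₀ x : ℝ) : ℂ) * f x) 2 volume) atTop (𝓝 0))
    {E : ℕ → ℝ} {E₀ : ℝ} (hE : Tendsto E atTop (𝓝 E₀)) {ψ g k : ℕ → L2 X}
    (hg : ∀ n, (ψ n, g n) ∈ negLaplacianGraph X)
    (hk : ∀ n, k n =ᵐ[volume] fun x => (W n x : ℂ) * ψ n x)
    (heq : ∀ n, g n + k n = (E n : ℂ) • ψ n) (hψ : ∀ n, ‖ψ n‖ = 1)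
    (hspread : ¬ TotallySpreading ψ) :
    ∃ ψ₀ g₀ k₀ : L2 X, ψ₀ ≠ 0 ∧ (ψ₀, g₀) ∈ negLaplacianGraph X ∧
      (k₀ =ᵐ[volume] fun x => (W₀ x : ℂ) * ψ₀ x) ∧ g₀ + k₀ = (E₀ : ℂ) • ψ₀ := by
  have : Fact ((2 : ℝ≥0∞) ≠ ⊤) := ⟨by norm_num⟩
  obtain ⟨B, hB, hBle⟩ := hG.2 (1 / 2) (by norm_num)
  obtain ⟨M, hM⟩ : ∃ M, ∀ n, |E n| ≤ M := by
    obtain ⟨M, hM⟩ := (hE.abs).bddAbove_range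
    exact ⟨M, fun n => hM ⟨n, rfl⟩⟩
  -- The equation gives `‖g‖ ≤ M + ‖k‖ ≤ M + ‖g‖ / 2 + B`; the relative bound `1 / 2` lets the
  -- middle term be absorbed.
  have hgb : ∀ n, ‖g n‖ ≤ 2 * (M + B) := by
    intro n
    have h1 : ‖k n‖ ≤ 1 / 2 * ‖g n‖ + B := by
      have h2 : eLpNorm (k n) 2 volume ≤ ENNReal.ofReal (1 / 2 * ‖g n‖ + B * ‖ψ n‖) := by
        refine (eLpNorm_mono_ae ?_).trans (hBle (ψ n) (g n) (hg n))
        filter_upwards [hk n, hWG n] with x hx1 hx2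
        rw [hx1, norm_mul, norm_mul, Complex.norm_real, Complex.norm_real]
        gcongr
        exact hx2.trans (le_abs_self _)
      rw [hψ n, mul_one, ← Lp.enorm_def, ← ofReal_norm] at h2
      exact (ENNReal.ofReal_le_ofReal_iff (by positivity)).mp h2
    have h2 : ‖g n‖ ≤ |E n| + ‖k n‖ := by
      rw [eq_sub_of_add_eq (heq n)]
      refine (norm_sub_le _ _).trans ?_
      rw [norm_smul, hψ n, Complex.norm_real, mul_one, Real.norm_eq_abs]
    linarith [hM n]
  simp only [TotallySpreading, not_forall] at hspread
  obtain ⟨R, hR, hnot⟩ := hspread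
  -- The whole subsequence `θ₀` keeps its mass on this ball outside a neighbourhood of zero, so no
  -- further subsequence can spread.
  obtain ⟨s, hs, hfreq⟩ := not_tendsto_iff_exists_frequently_notMem.mp hnot
  obtain ⟨θ₀, hθ₀, hθ₀s⟩ := extraction_of_frequently_atTop hfreq
  obtain ⟨ψ₀, θ₁, hθ₁, hψ₀⟩ := exists_subseq_tendsto_inner (x := fun n => ψ (θ₀ n)) (M := 1)
    (fun n => (hψ _).le)
  obtain ⟨g₀, θ₂, hθ₂, hg₀⟩ := exists_subseq_tendsto_inner (x := fun n => g (θ₀ (θ₁ n)))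
    (fun n => hgb _)
  let θ : ℕ → ℕ := fun n => θ₀ (θ₁ (θ₂ n))
  have hθ : Tendsto θ atTop atTop :=
    hθ₀.tendsto_atTop.comp (hθ₁.tendsto_atTop.comp hθ₂.tendsto_atTop)
  have hψw : ∀ v, Tendsto (fun n => inner ℂ v (ψ (θ n))) atTop (𝓝 (inner ℂ v ψ₀)) :=
    fun v => (hψ₀ v).comp hθ₂.tendsto_atTop
  have hgraph : (ψ₀, g₀) ∈ negLaplacianGraph X :=
    mem_negLaplacianGraph_of_tendsto_inner (fun n => hg (θ n)) hψw hg₀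
  have hk₀ := hW₀.memLp hgraph
  refine ⟨ψ₀, g₀, hk₀.toLp _, ?_, hgraph, hk₀.coeFn_toLp, ?_⟩
  · rintro rfl
    have hsp : TotallySpreading fun n => ψ (θ n) :=
      totallySpreading_of_tendsto_inner_zero (fun n => hg (θ n)) (fun n => (hψ _).le)
        (fun n => hgb _) (fun v => by simpa using hψw v)
    obtain ⟨n, hn⟩ := ((hsp R hR).eventually hs).exists
    exact hθ₀s _ hn
  -- By the equation `k` has a weak limit; testing against smooth functions of compact support shows
  -- that it is `W₀ ψ₀`.
  · have hkw : ∀ v, Tendsto (fun n => inner ℂ v (k (θ n))) atTop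
        (𝓝 (inner ℂ v ((E₀ : ℂ) • ψ₀ - g₀))) := by
      intro v
      have h1 : ∀ n, inner ℂ v (k (θ n)) =
          (E (θ n) : ℂ) * inner ℂ v (ψ (θ n)) - inner ℂ v (g (θ n)) := fun n => by
        rw [eq_sub_of_add_eq' (heq (θ n)), inner_sub_right, inner_smul_right]
      simp only [h1, inner_sub_right, inner_smul_right]
      refine Tendsto.sub (Tendsto.mul ?_ (hψw v)) (hg₀ v)
      exact (Complex.continuous_ofReal.tendsto _).comp (hE.comp hθ)
    rw [← eq_sub_iff_add_eq']
    set a : L2 X := (E₀ : ℂ) • ψ₀ - g₀ with ha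
    apply Lp.ext
    apply ae_eq_of_integral_contDiff_smul_eq (locallyIntegrable_of_memLp_two (Lp.memLp _))
      (locallyIntegrable_of_memLp_two (Lp.memLp _))
    intro φ hφ hφs
    have hc : HasCompactSupport (fun x => (φ x : ℂ)) :=
      hφs.comp_left (g := fun y : ℝ => (y : ℂ)) rfl
    have hd : ContDiff ℝ ∞ (fun x => (φ x : ℂ)) := Complex.ofRealCLM.contDiff.comp hφ
    let u : 𝓢(X, ℂ) := hc.toSchwartzMap hd
    have hu : ∀ x, u x = (φ x : ℂ) := fun x => rfl
    have hint : ∀ h : L2 X, ∫ x, φ x • h x = inner ℂ (u.toLp 2 volume) h := by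
      intro h
      rw [L2.inner_def]
      refine integral_congr_ae ?_
      filter_upwards [u.coeFn_toLp 2 volume] with x hx
      rw [hx, hu, RCLike.inner_apply, Complex.conj_ofReal, Complex.real_smul, mul_comm]
    -- A real potential moves onto the test function, where its convergence is strong.
    have hsym : ∀ (V : X → ℝ) (hV : MemLp (fun x => (V x : ℂ) * u x) 2 volume) (f h : L2 X),
        (h =ᵐ[volume] fun x => (V x : ℂ) * f x) →
        inner ℂ (u.toLp 2 volume) h = inner ℂ (hV.toLp _) f := by
      intro V hV f h hh
      rw [L2.inner_def, L2.inner_def]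
      refine integral_congr_ae ?_
      filter_upwards [u.coeFn_toLp 2 volume, hV.coeFn_toLp, hh] with x h1 h2 h3
      rw [h1, h2, h3, hu, RCLike.inner_apply, RCLike.inner_apply, map_mul, Complex.conj_ofReal,
        Complex.conj_ofReal]
      ring
    rw [hint, hint, hsym W₀ (hW₀.memLp_schwartz u) ψ₀ _ hk₀.coeFn_toLp]
    have hstrong : Tendsto (fun n => ((hW (θ n)).memLp_schwartz u).toLp _) atTop
        (𝓝 ((hW₀.memLp_schwartz u).toLp _)) := by
      rw [Lp.tendsto_Lp_iff_tendsto_eLpNorm'']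
      refine ((hlim _ hd hc).comp hθ).congr fun n => ?_
      simp only [Function.comp_apply]
      congr 1
      ext x
      simp only [Pi.sub_apply, hu]
      push_cast
      ring
    have h1 := tendsto_inner_of_tendsto hstrong (fun n => (hψ (θ n)).le)
      (hψw ((hW₀.memLp_schwartz u).toLp _))
    refine tendsto_nhds_unique h1 ((hkw (u.toLp 2 volume)).congr fun n => ?_)
    exact hsym (W (θ n)) _ _ _ (hk (θ n))

end WeakLimits

end NBody

end

/-! ### The theorem for `N` particles. -/

theorem theorem1 {N : ℕ} (hN : 2 ≤ N) (ℏ : ℝ) (hℏ : 0 < ℏ) (m : Fin N → ℝ) (hm : ∀ i, 0 < m i)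
    (V : ℝ → Fin N → Fin N → NBody.Space → ℝ)
    -- the parameter values
    (lam : ℕ → ℝ) (lamcr : ℝ) (hlam : Tendsto lam atTop (𝓝 lamcr))
    -- uniform domination of the pair potentials
    (F : NBody.Space → ℝ) (hF : NBody.MemL2AddLinfty F)
    (hV : ∀ l ∈ insert lamcr (Set.range lam), ∀ i j, i < j →
      NBody.MemL2AddLinfty (V l i j) ∧ ∀ᵐ y, |V l i j y| ≤ F y)
    -- convergence of the potentials on test functions
    (hVlim : ∀ f : NBody.RelSpace m → ℂ, ContDiff ℝ ∞ f → HasCompactSupport f →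
      Tendsto (fun n => eLpNorm (fun x =>
        ((NBody.totalPotential ℏ m (V (lam n)) x - NBody.totalPotential ℏ m (V lamcr) x : ℝ) : ℂ)
          * f x) 2 volume) atTop (𝓝 0))
    -- eigenvalues below the essential spectrum
    (E : ℕ → ℝ) (ψ : ℕ → NBody.L2 (NBody.RelSpace m))
    (hψdom : ∀ n, ψ n ∈ (NBody.kinetic m).domain)
    (hψ : ∀ n, ∃ h : ψ n ∈ (NBody.hamiltonian ℏ m (V (lam n))).domain,
      NBody.hamiltonian ℏ m (V (lam n)) ⟨ψ n, h⟩ = (E n : ℂ) • ψ n)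
    (hψnorm : ∀ n, ‖ψ n‖ = 1)
    (hE : ∀ n, E n < NBody.threshold ℏ m (V (lam n)))
    -- convergence to the threshold
    (hElim : Tendsto E atTop (𝓝 (NBody.threshold ℏ m (V lamcr))))
    (hthrlim : Tendsto (fun n => NBody.threshold ℏ m (V (lam n))) atTop
      (𝓝 (NBody.threshold ℏ m (V lamcr))))
    (hspread : ¬ NBody.TotallySpreading ψ) :
    ∃ ψcr : NBody.L2 (NBody.RelSpace m), ψcr ≠ 0 ∧ ψcr ∈ (NBody.kinetic m).domain ∧
      ∃ h : ψcr ∈ (NBody.hamiltonian ℏ m (V lamcr)).domain,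
        NBody.hamiltonian ℏ m (V lamcr) ⟨ψcr, h⟩
          = ((NBody.threshold ℏ m (V lamcr) : ℝ) : ℂ) • ψcr := by
  have hmem : ∀ n, lam n ∈ insert lamcr (Set.range lam) := fun n => Or.inr ⟨n, rfl⟩
  have hcr : lamcr ∈ insert lamcr (Set.range lam) := Or.inl rfl
  have hsmall : ∀ l ∈ insert lamcr (Set.range lam),
      NBody.RelativelySmall (NBody.totalPotential ℏ m (V l)) := fun l hl =>
    NBody.relativelySmall_totalPotential hℏ hm fun i j hij => (hV l hl i j hij).1
  choose g k hg hk heq using fun n => NBody.hamiltonian_eq_smul_iff.mp (hψ n)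
  obtain ⟨ψcr, g₀, k₀, hne, hg₀, hk₀, heq₀⟩ :=
    NBody.exists_eigenfunction_of_not_totallySpreading
      -- The majorant is the total potential whose pair potentials all equal `F`.
      (NBody.relativelySmall_totalPotential hℏ hm (V := fun _ _ => F) fun _ _ _ => hF)
      (hsmall _ hcr) (fun n => hsmall _ (hmem n))
      (fun n => NBody.abs_totalPotential_le_ae hℏ hm fun i j hij => (hV _ (hmem n) i j hij).2)
      hVlim hElim hg hk heq hψnorm hspread
  obtain ⟨h, he⟩ := NBody.hamiltonian_eq_smul_iff.mpr ⟨g₀, k₀, hg₀, hk₀, heq₀⟩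
  exact ⟨ψcr, hne, h.1, h, he⟩
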